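/- All tournaments are finite. An ordering $\theta=(v_1,\dots,v_n)$ of the vertices of a tournament $T$ has a graph of backward arcs $B(T,\theta)$: the undirected graph on $V(T)$ in which, for $i<j$, the vertices $v_i,v_j$ are adjacent if and only if $(v_j,v_i)$ is an arc of $T$. The boat is the tournament on $\{x,u,v,y\}$ with arcs $(y,x),(y,u),(v,x),(x,u),(u,v),(v,y)$; its path ordering is $(x,u,v,y)$, and the corresponding graph of backward arcs has the edges $yx, yu, vx$. A left boat (resp. right boat) in $B(T,\theta)$ is an induced subgraph on vertices $v_{i_1},v_{i_2},v_{i_3},v_{i_4}$, $i_1<i_2<i_3<i_4$, that under $v_{i_1}\mapsto x$, $v_{i_2}\mapsto u$, $v_{i_3}\mapsto v$, $v_{i_4}\mapsto y$ is the graph of backward arcs of the boat under its path ordering, and such that $i_3=i_2+1=i_1+2$ (resp. $i_4=i_3+1=i_2+2$). A tournament $T$ is a left flotilla (resp. right flotilla) if it has an ordering $\theta$ such that every connected component of $B(T,\theta)$ is a left boat (resp. right boat). A tournament $H$ satisfies the Erdős–Hajnal Conjecture (EHC) if there is $\epsilon>0$ such that every tournament $T$ with $n$ vertices that has no induced subtournament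 isomorphic to $H$ contains a transitive subtournament of size at least $n^{\epsilon}$. **Theorem.** Every left flotilla satisfies EHC, and every right flotilla satisfies EHC. -/

import Mathlib

universe u v

/-- A tournament on the vertex set `V`: a loopless digraph in which every two distinct vertices
are joined by exactly one of the two possible arcs. `T.Adj a b` means that `(a, b)` is an arc. -/
structure Tournament (V : Type u) extends Digraph V where
  loopless : ∀ a : V, ¬ Adj a a
  exactly_one : ∀ a b : V, a ≠ b → Xor (Adj a b) (Adj b a)

namespace Tournament

variable {V : Type u} {W : Type v}

/-- The subtournament `T | X` of `T` induced by a set `X` of vertices. -/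
def induce (T : Tournament V) (X : Set V) : Tournament X where
  Adj a b := T.Adj a b
  loopless a := T.loopless a
  exactly_one a b hab := T.exactly_one a b (fun h => hab (Subtype.ext h))

/-- Two tournaments are isomorphic. -/
def Isomorphic (S : Tournament V) (T : Tournament W) : Prop :=
  ∃ e : V ≃ W, ∀ a b : V, S.Adj a b ↔ T.Adj (e a) (e b)

/-- `T` contains `H`: `H` is isomorphic to `T | X` for some set `X` of vertices of `T`. -/
def Contains (T : Tournament W) (H : Tournament V) : Prop :=
  ∃ X : Set W, H.Isomorphic (T.induce X)

/-- A tournament is transitive if it has no directed cycle, that is, if no vertex can be reached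
from itself along a directed walk of positive length. -/
def IsTransitive (T : Tournament V) : Prop :=
  ∀ a : V, ¬ Relation.TransGen T.Adj a a

/-- `H` satisfies the Erdős–Hajnal conjecture: there is `ε > 0` such that every finite tournament
with `n` vertices that does not contain `H` has a transitive subtournament of size at least
`n ^ ε`. -/
def SatisfiesEHC (H : Tournament V) : Prop :=
  ∃ ε : ℝ, 0 < ε ∧
    ∀ (W : Type v) [Fintype W] (T : Tournament W), ¬ T.Contains H →
      ∃ X : Finset W, (T.induce (X : Set W)).IsTransitive ∧
        (Fintype.card W : ℝ) ^ ε ≤ (X.card : ℝ)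

/-- `(a, b)` is a backward arc of `T` under the ordering `θ = (θ 0, …, θ (n - 1))` of its
vertices. -/
def IsBackwardArc (T : Tournament V) {n : ℕ} (θ : Fin n ≃ V) (a b : V) : Prop :=
  T.Adj a b ∧ θ.symm b < θ.symm a

/-- The graph of backward arcs `B(T, θ)`. -/
def backGraph (T : Tournament V) {n : ℕ} (θ : Fin n ≃ V) : SimpleGraph V where
  Adj a b := T.IsBackwardArc θ a b ∨ T.IsBackwardArc θ b a
  symm := ⟨fun _ _ h => Or.symm h⟩
  loopless := ⟨fun a h => h.elim (fun h' => T.loopless a h'.1) (fun h' => T.loopless a h'.1)⟩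

/-- The boat `{x, u, v, y}`, with `x = 0`, `u = 1`, `v = 2`, `y = 3`. -/
def boat : Tournament (Fin 4) where
  Adj a b := (a, b) = (3, 0) ∨ (a, b) = (3, 1) ∨ (a, b) = (2, 0) ∨
    (a, b) = (0, 1) ∨ (a, b) = (1, 2) ∨ (a, b) = (2, 3)
  loopless := by decide
  exactly_one := by unfold Xor; decide

/-- The path ordering `(x, u, v, y)` of the boat. -/
def boatPathOrdering : Fin 4 ≃ Fin 4 := Equiv.refl (Fin 4)

/-- The vertices of `T` in the positions `i 0 < i 1 < i 2 < i 3` under `θ` induce in `B(T, θ)` the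
graph of backward arcs of a boat under its path ordering. -/
def IsBoatAt (T : Tournament V) {n : ℕ} (θ : Fin n ≃ V) (i : Fin 4 → Fin n) : Prop :=
  StrictMono i ∧ ∀ a b : Fin 4,
    (T.backGraph θ).Adj (θ (i a)) (θ (i b)) ↔ (boat.backGraph boatPathOrdering).Adj a b

/-- A left boat: the first three of the four positions are consecutive. -/
def IsLeftBoat (T : Tournament V) {n : ℕ} (θ : Fin n ≃ V) (i : Fin 4 → Fin n) : Prop :=
  T.IsBoatAt θ i ∧ (i 1 : ℕ) = (i 0 : ℕ) + 1 ∧ (i 2 : ℕ) = (i 1 : ℕ) + 1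

/-- A right boat: the last three of the four positions are consecutive. -/
def IsRightBoat (T : Tournament V) {n : ℕ} (θ : Fin n ≃ V) (i : Fin 4 → Fin n) : Prop :=
  T.IsBoatAt θ i ∧ (i 2 : ℕ) = (i 1 : ℕ) + 1 ∧ (i 3 : ℕ) = (i 2 : ℕ) + 1

/-- `T` is a left flotilla: for some ordering `θ` of its vertices, every connected component of
`B(T, θ)` is a left boat. -/
def IsLeftFlotilla (T : Tournament V) : Prop :=
  ∃ (n : ℕ) (θ : Fin n ≃ V), ∀ C : (T.backGraph θ).ConnectedComponent,
    ∃ i : Fin 4 → Fin n, T.IsLeftBoat θ i ∧ C.supp = Set.range (fun k => θ (i k))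

/-- `T` is a right flotilla: for some ordering `θ` of its vertices, every connected component of
`B(T, θ)` is a right boat. -/
def IsRightFlotilla (T : Tournament V) : Prop :=
  ∃ (n : ℕ) (θ : Fin n ≃ V), ∀ C : (T.backGraph θ).ConnectedComponent,
    ∃ i : Fin 4 → Fin n, T.IsRightBoat θ i ∧ C.supp = Set.range (fun k => θ (i k))

end Tournament

/-!
If the conjecture fails for `H` with a small exponent `ε`, there is a tournament `T` not containing
`H` with a minimal set `X` of vertices whose largest transitive subset has fewer than `#X ^ ε`
elements. As `T` does not contain `H`, the set `X` contains a long sequence of disjoint sets, each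
of them a constant fraction of `X`, such that every vertex is joined by backward arcs to only a few
vertices of each other set. In a left boat of a flotilla the vertices `x`, `u`, `v` are consecutive,
so it is enough to find them in one set `B` of the sequence and `y` in a later set `Y`; the boats
are then chosen one after the other, each time discarding the few vertices that are joined by
backward arcs to the boats already chosen. Right flotillas become left ones when all arcs are
reversed.

To find a boat with `x`, `u`, `v` in `B` and `y` in `Y` is to find a cyclic triangle in `B` two of
whose vertices are out-neighbours of some `y` in `Y`, but not the third. If there is none, each
out-neighbourhood `N y` in `B` contains every cyclic triangle of `B` of which it contains two
vertices. Therefore the maximal subsets of the sets `N y` inducing strong subtournaments are modules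
of `B`, and together with single vertices they partition `B` in such a way that each `N y` becomes
transitive when the parts are contracted. Choosing a largest transitive subset in each part that
meets `N y` gives a transitive set, so the transitive numbers of these parts add up to at most that
of `B`. Summing over `y`, one finds that the parts that meet too many of the sets `N y`, relative to
their transitive number, cover at most half of `B`. Hence a largest transitive subset `Z` of the
rest of `B` is disjoint from `N y` for at least half of the `y` in `Y`, that is, all arcs between
`Z` and these `y` leave `Z`. The union of `Z` and a largest transitive set of such `y` then has at
least `#X ^ ε` elements, a contradiction.
-/

open scoped Classical Finset

theorem exists_finpartition_of_laminar {α : Type*} {B : Finset α} {F : Set (Finset α)}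
    (hne : ∀ M ∈ F, M.Nonempty) (hsub : ∀ M ∈ F, M ⊆ B)
    (hlam : ∀ M ∈ F, ∀ M' ∈ F, ¬ Disjoint M M' → M ⊆ M' ∨ M' ⊆ M)
    (hcov : ∀ a ∈ B, ∃ M ∈ F, a ∈ M) :
    ∃ P : Finpartition B, (∀ M ∈ P.parts, M ∈ F) ∧ ∀ M ∈ F, ∃ M' ∈ P.parts, M ⊆ M' := by
  have hfin : F.Finite := B.powerset.finite_toSet.subset fun M hM =>
    Finset.mem_coe.2 (Finset.mem_powerset.2 (hsub M hM))
  have hmax : ∀ M ∈ F, ∃ M', M ⊆ M' ∧ Maximal (· ∈ F) M' := fun M hM =>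
    hfin.exists_le_maximal hM
  have mem_parts : ∀ M, M ∈ {M ∈ B.powerset | Maximal (· ∈ F) M} ↔ Maximal (· ∈ F) M := by
    simp only [Finset.mem_filter, Finset.mem_powerset, and_iff_right_iff_imp]
    exact fun M hM => hsub M hM.prop
  refine ⟨.ofExistsUnique {M ∈ B.powerset | Maximal (· ∈ F) M}
    (fun M hM => hsub M ((mem_parts M).1 hM).prop) (fun a ha => ?_)
    (fun h => Finset.not_nonempty_empty (hne ∅ ((mem_parts ∅).1 h).prop)),
    fun M hM => ((mem_parts M).1 hM).prop, fun M hM => ?_⟩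
  · obtain ⟨M, hM, haM⟩ := hcov a ha
    obtain ⟨M', hMM', hM'⟩ := hmax M hM
    refine ⟨M', ⟨(mem_parts M').2 hM', hMM' haM⟩, fun M'' ⟨hM'', haM''⟩ => ?_⟩
    have hM'' := (mem_parts M'').1 hM''
    rcases hlam M'' hM''.prop M' hM'.prop
      (Finset.not_disjoint_iff.2 ⟨a, haM'', hMM' haM⟩) with h | h
    · exact hM''.eq_of_le hM'.prop h
    · exact hM'.eq_of_ge hM''.prop h
  · obtain ⟨M', hMM', hM'⟩ := hmax M hM
    exact ⟨M', (mem_parts M').2 hM', hMM'⟩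

theorem ssubset_of_subset_of_disjoint {α : Type*} {A B X : Finset α} (hA : A ⊆ X) (hB : B ⊆ X)
    (hne : B.Nonempty) (hAB : Disjoint A B) : A ⊂ X :=
  hA.ssubset_of_not_subset fun hXA =>
    hne.ne_empty (Finset.disjoint_self_iff_empty B |>.1 (hAB.mono_left (hB.trans hXA)))

theorem rpow_le_two_of_rpow_two_mul_le {K ε : ℝ} (hK0 : 0 ≤ K) (hK : K ^ (2 * ε) ≤ 2) :
    K ^ ε ≤ 2 := by
  rw [mul_comm, Real.rpow_mul hK0, Real.rpow_two] at hK
  nlinarith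

theorem exists_pos_rpow_two_mul_le_two {K : ℝ} (hK : 0 < K) :
    ∃ ε : ℝ, 0 < ε ∧ 2 * ε ≤ 1 ∧ K ^ (2 * ε) ≤ 2 := by
  have hlim : Filter.Tendsto (fun ε : ℝ => K ^ (2 * ε)) (nhds 0) (nhds 1) := by
    have : Continuous fun ε : ℝ => K ^ (2 * ε) :=
      (Real.continuous_const_rpow hK.ne').comp (continuous_const.mul continuous_id)
    simpa using this.tendsto 0
  have hev : ∀ᶠ ε in nhdsWithin (0 : ℝ) (Set.Ioi 0), K ^ (2 * ε) < 2 :=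
    nhdsWithin_le_nhds (hlim.eventually (gt_mem_nhds one_lt_two))
  obtain ⟨ε, hεK, hε0, hε⟩ := (hev.and (Ioo_mem_nhdsGT (one_half_pos (α := ℝ)))).exists
  exact ⟨ε, hε0, by linarith, hεK.le⟩

theorem exists_pairwise_disjoint_subsets {α : Type*} {n : ℕ} {X : Finset α} (hn : n ≤ #X) :
    ∃ S : Fin n → Finset α, (∀ i, S i ⊆ X) ∧ Pairwise (Function.onFun Disjoint S) ∧
      ∀ i, #X ≤ 2 * n * #(S i) := by
  rcases Nat.eq_zero_or_pos n with rfl | hn0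
  · exact ⟨Fin.elim0, fun i => i.elim0, fun i => i.elim0, fun i => i.elim0⟩
  obtain ⟨P, hP, hcard⟩ := Finpartition.exists_equipartition_card_eq X hn0.ne' hn
  let e : Fin n ≃ P.parts := (Fintype.equivFinOfCardEq (by simp [hcard])).symm
  refine ⟨fun i => e i, fun i => P.le (e i).2, fun i j hij => P.disjoint (e i).2 (e j).2
    fun h => hij (e.injective (Subtype.ext h)), fun i => ?_⟩
  have havg := hP.average_le_card_part (e i).2
  rw [hcard] at havg
  have hpos : 1 ≤ #X / n := (Nat.one_le_div_iff hn0).2 hn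
  calc #X ≤ n * (#X / n + 1) := (Nat.lt_mul_div_succ #X hn0).le
    _ ≤ n * (2 * #(e i : Finset α)) := by gcongr; omega
    _ = 2 * n * #(e i : Finset α) := by ring

section SparsePairs

variable {α β : Type*} {A A' : Finset α} {B : Finset β} {r : α → β → Prop} {δ η : ℝ}

/-- At most a proportion `δ` of the pairs in `A × B` satisfies `r`. -/
def IsSparsePair (r : α → β → Prop) (δ : ℝ) (A : Finset α) (B : Finset β) : Prop :=
  (#(Rel.interedges r A B) : ℝ) ≤ δ * #A * #B

theorem card_interedges_swap (r : α → β → Prop) (A : Finset α) (B : Finset β) :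
    #(Rel.interedges (Function.swap r) B A) = #(Rel.interedges r A B) := by
  simp only [Rel.interedges, Finset.card_filter, Finset.sum_product_right (s := A),
    Finset.sum_product, Function.swap]

theorem IsSparsePair.swap (h : IsSparsePair r δ A B) : IsSparsePair (Function.swap r) δ B A := by
  rw [IsSparsePair, card_interedges_swap, mul_right_comm]
  exact h

theorem isSparsePair_iff_sum_le :
    IsSparsePair r δ A B ↔ ∑ v ∈ A, (#{w ∈ B | r v w} : ℝ) ≤ δ * #A * #B := by
  rw [IsSparsePair, ← Nat.cast_sum]
  simp only [Rel.interedges, Finset.card_filter, Finset.sum_product]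

theorem isSparsePair_of_forall_card_le (h : ∀ v ∈ A, (#{w ∈ B | r v w} : ℝ) ≤ δ * #B) :
    IsSparsePair r δ A B := by
  rw [isSparsePair_iff_sum_le]
  calc ∑ v ∈ A, (#{w ∈ B | r v w} : ℝ) ≤ ∑ _v ∈ A, δ * #B := Finset.sum_le_sum h
    _ = δ * #A * #B := by rw [Finset.sum_const, nsmul_eq_mul]; ring

theorem IsSparsePair.mono_left (h : IsSparsePair r (δ * η) A B) (hδ : 0 ≤ δ) (hA' : A' ⊆ A)
    (hη : η * #A ≤ #A') : IsSparsePair r δ A' B :=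
  calc (#(Rel.interedges r A' B) : ℝ) ≤ #(Rel.interedges r A B) := by
        exact_mod_cast Finset.card_le_card (Rel.interedges_mono (r := r) hA' subset_rfl)
    _ ≤ δ * η * #A * #B := h
    _ = δ * (η * #A) * #B := by ring
    _ ≤ δ * #A' * #B := by gcongr

theorem IsSparsePair.card_filter_lt_le (h : IsSparsePair r (δ * η) A B) (hδ : 0 < δ)
    (hη : 0 ≤ η) : (#{v ∈ A | δ * #B < #{w ∈ B | r v w}} : ℝ) ≤ η * #A := by
  rcases B.eq_empty_or_nonempty with rfl | hB
  · simpa using by positivity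
  have hBpos : (0 : ℝ) < δ * #B := mul_pos hδ (by exact_mod_cast hB.card_pos)
  refine le_of_mul_le_mul_right ?_ hBpos
  calc (#{v ∈ A | δ * #B < #{w ∈ B | r v w}} : ℝ) * (δ * #B)
      = ∑ _v ∈ A with δ * #B < #{w ∈ B | r _v w}, δ * #B := by
        rw [Finset.sum_const, nsmul_eq_mul]
    _ ≤ ∑ v ∈ A with δ * #B < #{w ∈ B | r v w}, (#{w ∈ B | r v w} : ℝ) :=
        Finset.sum_le_sum fun v hv => (Finset.mem_filter.1 hv).2.le
    _ ≤ ∑ v ∈ A, (#{w ∈ B | r v w} : ℝ) :=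
        Finset.sum_le_sum_of_subset_of_nonneg (Finset.filter_subset _ _)
          fun _ _ _ => Nat.cast_nonneg _
    _ ≤ δ * η * #A * #B := isSparsePair_iff_sum_le.1 h
    _ = η * #A * (δ * #B) := by ring

theorem exists_forall_card_ge_or_isSparsePair {ι : Type*} [Fintype ι] (δ : ℝ) (hA : A.Nonempty)
    (r : ι → α → β → Prop) (S : ι → Finset β) :
    (∃ v ∈ A, ∀ j, δ * #(S j) ≤ #{w ∈ S j | r j v w}) ∨
      ∃ j, ∃ A' ⊆ A, (#A : ℝ) ≤ Fintype.card ι * #A' ∧ IsSparsePair (r j) δ A' (S j) := by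
  by_contra! hcon
  obtain ⟨hfew, hno⟩ := hcon
  have : Nonempty ι := let ⟨v, hv⟩ := hA; let ⟨j, _⟩ := hfew v hv; ⟨j⟩
  choose! f hf using hfew
  have hι : (0 : ℝ) < Fintype.card ι := by exact_mod_cast Fintype.card_pos
  obtain ⟨j, -, hj⟩ := Finset.exists_le_card_fiber_of_nsmul_le_card_of_maps_to
    (fun v _ => Finset.mem_univ (f v)) Finset.univ_nonempty (b := (#A : ℝ) / Fintype.card ι)
    (by rw [Finset.card_univ, nsmul_eq_mul, mul_div_cancel₀ _ hι.ne'])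
  refine hno j {v ∈ A | f v = j} (Finset.filter_subset _ _) ((div_le_iff₀' hι).1 hj)
    (isSparsePair_of_forall_card_le fun v hv => ?_)
  obtain ⟨hvA, rfl⟩ := Finset.mem_filter.1 hv
  exact (hf v hvA).le

theorem exists_transversal_or_isSparsePair {δ : ℝ} (hδ : 0 < δ) (h : ℕ) :
    ∃ c : ℝ, 0 < c ∧ ∀ {α : Type v} (r : Fin h → Fin h → α → α → Prop) (S : Fin h → Finset α)
      (s : ℝ), 0 < s → (∀ i, s ≤ #(S i)) →
      (∃ φ : Fin h → α, (∀ i, φ i ∈ S i) ∧ ∀ i j, i < j → r i j (φ i) (φ j)) ∨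
        ∃ i j, i < j ∧ ∃ A ⊆ S i, ∃ B ⊆ S j,
          c * s ≤ #A ∧ c * s ≤ #B ∧ IsSparsePair (r i j) δ A B := by
  induction h with
  | zero => exact ⟨1, one_pos, fun _ _ _ _ _ => .inl ⟨Fin.elim0, fun i => i.elim0,
      fun i => i.elim0⟩⟩
  | succ h ih =>
    obtain ⟨c, hc, ih⟩ := ih
    set c' := min (c * δ) (1 / (h + 1))
    have hc'0 : 0 < c' := by positivity
    refine ⟨c', hc'0, fun r S s hs hS => ?_⟩
    have hc's : c' * s ≤ c * (δ * s) := by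
      rw [← mul_assoc]
      exact mul_le_mul_of_nonneg_right (min_le_left _ _) hs.le
    have hc's' : (h + 1) * (c' * s) ≤ s := by
      rw [← mul_assoc]
      exact mul_le_of_le_one_left hs.le ((le_div_iff₀' (by positivity)).1 (min_le_right _ _))
    have hS0 : (S 0).Nonempty := Finset.card_pos.1 (by exact_mod_cast hs.trans_le (hS 0))
    rcases exists_forall_card_ge_or_isSparsePair δ hS0 (fun j => r 0 (Fin.succ j))
      fun j => S j.succ with ⟨v, hv, hvS⟩ | ⟨j, A, hA, hAcard, hsparse⟩
    · rcases ih (fun i j => r i.succ j.succ) (fun j => {w ∈ S j.succ | r 0 j.succ v w}) (δ * s)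
        (by positivity) (fun j => (mul_le_mul_of_nonneg_left (hS _) hδ.le).trans (hvS j)) with
        ⟨φ, hφS, hφ⟩ | ⟨i, j, hij, A, hA, B, hB, hAcard, hBcard, hsparse⟩
      · simp only [Finset.mem_filter] at hφS
        refine .inl ⟨Fin.cons v φ, Fin.forall_fin_succ.2 ⟨hv, fun j => (hφS j).1⟩,
          Fin.forall_fin_succ.2 ⟨Fin.forall_fin_succ.2 ⟨fun h0 => absurd h0 (lt_irrefl 0),
            fun j _ => (hφS j).2⟩, fun i => Fin.forall_fin_succ.2
            ⟨fun hi => absurd hi (Fin.not_lt_zero _), fun j hij => ?_⟩⟩⟩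
        exact hφ i j (Fin.succ_lt_succ_iff.1 hij)
      · exact .inr ⟨i.succ, j.succ, Fin.succ_lt_succ_iff.2 hij, A,
          hA.trans (Finset.filter_subset _ _), B, hB.trans (Finset.filter_subset _ _),
          hc's.trans hAcard, hc's.trans hBcard, hsparse⟩
    · rw [Fintype.card_fin] at hAcard
      have hc's0 : 0 < c' * s := by positivity
      exact .inr ⟨0, j.succ, j.succ_pos, A, hA, S j.succ, subset_rfl, by nlinarith [hS 0],
        by nlinarith [hS j.succ], hsparse⟩

theorem exists_subset_forall_not_of_card_le {τ : Type*} {t : Finset τ} {p : τ → α → Prop}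
    [∀ i, DecidablePred (p i)] (hp : ∀ i ∈ t, (#{a ∈ A | p i a} : ℝ) ≤ η * #A)
    (hη : 2 * #t * η ≤ 1) :
    ∃ A' ⊆ A, #A ≤ 2 * #A' ∧ ∀ a ∈ A', ∀ i ∈ t, ¬ p i a := by
  refine ⟨{a ∈ A | ∀ i ∈ t, ¬ p i a}, Finset.filter_subset _ _, ?_,
    fun a ha => (Finset.mem_filter.1 ha).2⟩
  have hunion : {a ∈ A | ¬ ∀ i ∈ t, ¬ p i a} = t.biUnion fun i => {a ∈ A | p i a} := by
    ext a
    simp only [not_forall, not_not, Finset.mem_filter, Finset.mem_biUnion]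
    tauto
  have hbad : 2 * (#{a ∈ A | ¬ ∀ i ∈ t, ¬ p i a} : ℝ) ≤ #A := calc
    2 * (#{a ∈ A | ¬ ∀ i ∈ t, ¬ p i a} : ℝ) ≤ 2 * ∑ i ∈ t, (#{a ∈ A | p i a} : ℝ) := by
        rw [hunion]
        exact_mod_cast Nat.mul_le_mul_left 2 Finset.card_biUnion_le
    _ ≤ 2 * ∑ _i ∈ t, η * #A := by gcongr with i hi; exact hp i hi
    _ = 2 * #t * η * #A := by rw [Finset.sum_const, nsmul_eq_mul]; ring
    _ ≤ #A := mul_le_of_le_one_left (Nat.cast_nonneg _) hη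
  have hbad' : 2 * #{a ∈ A | ¬ ∀ i ∈ t, ¬ p i a} ≤ #A := by exact_mod_cast hbad
  have := Finset.card_filter_add_card_filter_not (s := A) fun a => ∀ i ∈ t, ¬ p i a
  omega

theorem exists_subsets_forall_card_le {ι : Type*} [Fintype ι] {S : ι → Finset α}
    {r : ι → ι → α → α → Prop} (hδ : 0 < δ)
    (hr : ∀ i j, IsSparsePair (r i j) (δ / 2 * (1 / (2 * Fintype.card ι))) (S i) (S j)) :
    ∃ S' : ι → Finset α, (∀ i, S' i ⊆ S i) ∧ (∀ i, #(S i) ≤ 2 * #(S' i)) ∧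
      ∀ i j, ∀ v ∈ S' i, (#{w ∈ S' j | r i j v w} : ℝ) ≤ δ * #(S' j) := by
  have hη : 2 * #(Finset.univ : Finset ι) * (1 / (2 * Fintype.card ι) : ℝ) ≤ 1 := by
    rw [Finset.card_univ, mul_one_div]
    exact div_self_le_one _
  choose S' hsub hcard hS' using fun i => exists_subset_forall_not_of_card_le
    (fun j _ => (hr i j).card_filter_lt_le (half_pos hδ) (by positivity)) hη
  refine ⟨S', hsub, hcard, fun i j v hv => ?_⟩
  have hcardj : (#(S j) : ℝ) ≤ 2 * #(S' j) := by exact_mod_cast hcard j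
  calc (#{w ∈ S' j | r i j v w} : ℝ) ≤ #{w ∈ S j | r i j v w} := by
        exact_mod_cast Finset.card_le_card (Finset.filter_subset_filter _ (hsub j))
    _ ≤ δ / 2 * #(S j) := not_lt.1 (hS' i v hv j (Finset.mem_univ j))
    _ ≤ δ / 2 * (2 * #(S' j)) := by gcongr
    _ = δ * #(S' j) := by ring

theorem exists_forall_and_pairwise_of_extend {ι β : Type*} [Finite ι] {P : ι → β → Prop}
    {R : ι → ι → β → β → Prop} (hR : ∀ i j b b', R i j b b' → R j i b' b) (φ₀ : ι → β)
    (hext : ∀ (s : Finset ι) (φ : ι → β), (∀ i ∈ s, P i (φ i)) →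
      ∀ j, ∃ b, P j b ∧ ∀ i ∈ s, R i j (φ i) b) :
    ∃ φ : ι → β, (∀ i, P i (φ i)) ∧ ∀ i j, i ≠ j → R i j (φ i) (φ j) := by
  have := Fintype.ofFinite ι
  suffices h : ∀ s : Finset ι, ∃ φ : ι → β, (∀ i ∈ s, P i (φ i)) ∧
      ∀ i ∈ s, ∀ j ∈ s, i ≠ j → R i j (φ i) (φ j) by
    obtain ⟨φ, hφ, hφ'⟩ := h Finset.univ
    exact ⟨φ, fun i => hφ i (Finset.mem_univ i), fun i j =>
      hφ' i (Finset.mem_univ i) j (Finset.mem_univ j)⟩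
  intro s
  induction s using Finset.induction_on with
  | empty => exact ⟨φ₀, by simp, by simp⟩
  | insert k s hk ih =>
    obtain ⟨φ, hφ, hφ'⟩ := ih
    obtain ⟨b, hb, hbφ⟩ := hext s φ hφ k
    have hupdate : ∀ i ∈ s, Function.update φ k b i = φ i := fun i hi =>
      Function.update_of_ne (ne_of_mem_of_not_mem hi hk) _ _
    refine ⟨Function.update φ k b, Finset.forall_mem_insert _ _ _ |>.2 ⟨?_, fun i hi => ?_⟩,
      fun i hi j hj hij => ?_⟩
    · rwa [Function.update_self]
    · rw [hupdate i hi]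
      exact hφ i hi
    rcases Finset.mem_insert.1 hi with rfl | his <;> rcases Finset.mem_insert.1 hj with rfl | hjs
    · exact absurd rfl hij
    · rw [Function.update_self, hupdate j hjs]
      exact hR _ _ _ _ (hbφ j hjs)
    · rw [hupdate i his, Function.update_self]
      exact hbφ i his
    · rw [hupdate i his, hupdate j hjs]
      exact hφ' i his j hjs hij

theorem exists_family_avoiding {ι τ κ : Type*} [Fintype ι] [Fintype τ] {S : κ → Finset α}
    {r : κ → κ → α → α → Prop} (hsymm : ∀ j j' v w, r j j' v w → r j' j w v)
    (hr : ∀ j j', ∀ v ∈ S j, (#{w ∈ S j' | r j j' v w} : ℝ) ≤ δ * #(S j')) (hδ : 0 ≤ δ)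
    (hsize : 2 * (Fintype.card ι * Fintype.card τ) * δ ≤ 1) (pos : ι → τ → κ)
    (Q : ι → (τ → α) → Prop)
    (hQ : ∀ C, ∀ S' : κ → Finset α, (∀ j, S' j ⊆ S j) → (∀ j, #(S j) ≤ 2 * #(S' j)) →
      ∃ ψ : τ → α, (∀ a, ψ a ∈ S' (pos C a)) ∧ Q C ψ) :
    ∃ φ : ι → τ → α, (∀ C, (∀ a, φ C a ∈ S (pos C a)) ∧ Q C (φ C)) ∧
      ∀ C C', C ≠ C' → ∀ a a', ¬ r (pos C a) (pos C' a') (φ C a) (φ C' a') := by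
  choose φ₀ _ using fun C => hQ C S (fun _ => subset_rfl) fun _ => Nat.le_mul_of_pos_left _ two_pos
  refine exists_forall_and_pairwise_of_extend (P := fun C ψ => (∀ a, ψ a ∈ S (pos C a)) ∧ Q C ψ)
    (R := fun C C' ψ ψ' => ∀ a a', ¬ r (pos C a) (pos C' a') (ψ a) (ψ' a'))
    (fun C C' ψ ψ' h a a' hr' => h a' a (hsymm _ _ _ _ hr')) φ₀ fun s φ hφ C => ?_
  have hsize' : 2 * #(s ×ˢ (Finset.univ : Finset τ)) * δ ≤ 1 := by
    refine le_trans ?_ hsize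
    rw [Finset.card_product, Nat.cast_mul, Finset.card_univ]
    gcongr
    exact Finset.card_le_univ s
  choose S' hsub hcard hS' using fun j => exists_subset_forall_not_of_card_le
    (fun (i : ι × τ) hi => hr (pos i.1 i.2) j _ ((hφ i.1 (Finset.mem_product.1 hi).1).1 i.2)) hsize'
  obtain ⟨ψ, hψS', hψ⟩ := hQ C S' hsub hcard
  exact ⟨ψ, ⟨fun a => hsub _ (hψS' a), hψ⟩, fun C' hC' a' a =>
    hS' _ _ (hψS' a) (C', a') (Finset.mk_mem_product hC' (Finset.mem_univ a'))⟩

end SparsePairs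

namespace Tournament

section TransitiveSets

variable {W : Type*} {T : Tournament W} {a b c : W}

theorem adj_asymm (h : T.Adj a b) : ¬ T.Adj b a := fun h' => by
  rcases eq_or_ne a b with rfl | hab
  · exact T.loopless a h
  · exact (T.exactly_one a b hab).elim (fun h'' => h''.2 h') fun h'' => h''.2 h

theorem ne_of_adj (h : T.Adj a b) : a ≠ b := by
  rintro rfl
  exact T.loopless a h

theorem adj_of_not_adj (hab : a ≠ b) (h : ¬ T.Adj a b) : T.Adj b a :=
  (T.exactly_one a b hab).or.resolve_left h

/-- The vertices `a`, `b`, `c` form a directed cycle of length three, in this order. -/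
def IsCyclicTriangle (T : Tournament W) (a b c : W) : Prop :=
  T.Adj a b ∧ T.Adj b c ∧ T.Adj c a

theorem IsCyclicTriangle.rotate (h : T.IsCyclicTriangle a b c) : T.IsCyclicTriangle b c a :=
  ⟨h.2.1, h.2.2, h.1⟩

/-- The subtournament induced by `Z` is transitive, expressed through the absence of cyclic
triangles. -/
def IsTransitiveOn (T : Tournament W) (Z : Finset W) : Prop :=
  ∀ ⦃a⦄, a ∈ Z → ∀ ⦃b⦄, b ∈ Z → ∀ ⦃c⦄, c ∈ Z → ¬ T.IsCyclicTriangle a b c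

theorem IsTransitiveOn.adj_trans {Z : Finset W} (h : T.IsTransitiveOn Z) (ha : a ∈ Z)
    (hb : b ∈ Z) (hc : c ∈ Z) (hab : T.Adj a b) (hbc : T.Adj b c) : T.Adj a c := by
  have hne : c ≠ a := by
    rintro rfl
    exact adj_asymm hab hbc
  exact adj_of_not_adj hne fun hca => h ha hb hc ⟨hab, hbc, hca⟩

theorem IsTransitiveOn.isTransitive_induce {Z : Finset W} (h : T.IsTransitiveOn Z) :
    (T.induce (Z : Set W)).IsTransitive := by
  have adj_of_transGen : ∀ a b, Relation.TransGen (T.induce (Z : Set W)).Adj a b → T.Adj a b := by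
    intro a b hab
    induction hab with
    | single hab => exact hab
    | tail _ hbc ih => exact h.adj_trans a.2 (Subtype.prop _) (Subtype.prop _) ih hbc
  exact fun a ha => T.loopless a (adj_of_transGen a a ha)

theorem isTransitiveOn_of_card_le_two {Z : Finset W} (hZ : #Z ≤ 2) : T.IsTransitiveOn Z := by
  intro a ha b hb c hc h
  have h3 : #{a, b, c} = 3 := Finset.card_eq_three.2
    ⟨a, b, c, ne_of_adj h.1, (ne_of_adj h.2.2).symm, ne_of_adj h.2.1, rfl⟩
  have : #{a, b, c} ≤ #Z := Finset.card_le_card (by simp [Finset.insert_subset_iff, ha, hb, hc])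
  omega

/-- The largest size of a subset of `X` that induces a transitive subtournament. -/
noncomputable def tr (T : Tournament W) (X : Finset W) : ℕ :=
  {Z ∈ X.powerset | T.IsTransitiveOn Z}.sup Finset.card

theorem IsTransitiveOn.card_le_tr {X Z : Finset W} (h : T.IsTransitiveOn Z) (hZ : Z ⊆ X) :
    #Z ≤ T.tr X :=
  Finset.le_sup (f := Finset.card) (by simpa using ⟨hZ, h⟩)

theorem exists_isTransitiveOn_card_eq_tr (T : Tournament W) (X : Finset W) :
    ∃ Z ⊆ X, T.IsTransitiveOn Z ∧ #Z = T.tr X := by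
  have hne : {Z ∈ X.powerset | T.IsTransitiveOn Z}.Nonempty :=
    ⟨∅, by simpa using isTransitiveOn_of_card_le_two (by simp)⟩
  obtain ⟨Z, hZ, hZX⟩ := Finset.exists_mem_eq_sup _ hne Finset.card
  rw [Finset.mem_filter, Finset.mem_powerset] at hZ
  exact ⟨Z, hZ.1, hZ.2, hZX.symm⟩

theorem tr_mono {X Y : Finset W} (h : X ⊆ Y) : T.tr X ≤ T.tr Y := by
  obtain ⟨Z, hZX, hZ, hZc⟩ := T.exists_isTransitiveOn_card_eq_tr X
  exact hZc ▸ hZ.card_le_tr (hZX.trans h)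

theorem tr_pos {X : Finset W} (hX : X.Nonempty) : 0 < T.tr X := by
  obtain ⟨a, ha⟩ := hX
  have : #{a} ≤ T.tr X :=
    (isTransitiveOn_of_card_le_two (by simp)).card_le_tr (Finset.singleton_subset_iff.2 ha)
  rwa [Finset.card_singleton] at this

theorem IsTransitiveOn.union {Z Z' : Finset W} (h : T.IsTransitiveOn Z) (h' : T.IsTransitiveOn Z')
    (hadj : ∀ a ∈ Z, ∀ b ∈ Z', T.Adj a b) : T.IsTransitiveOn (Z ∪ Z') := by
  have mem_left : ∀ a ∈ Z ∪ Z', ∀ b ∈ Z, T.Adj a b → a ∈ Z := fun a ha b hb hab =>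
    (Finset.mem_union.1 ha).resolve_right fun ha' => adj_asymm hab (hadj b hb a ha')
  intro a ha b hb c hc habc
  rcases Finset.mem_union.1 ha with haZ | haZ
  · have hcZ := mem_left c hc a haZ habc.2.2
    exact h haZ (mem_left b hb c hcZ habc.2.1) hcZ habc
  · have haZ' : a ∉ Z := fun ha' => T.loopless a (hadj a ha' a haZ)
    have hbZ : b ∉ Z := fun hbZ => haZ' (mem_left a ha b hbZ habc.1)
    have hcZ : c ∉ Z := fun hcZ => hbZ (mem_left b hb c hcZ habc.2.1)
    exact h' haZ ((Finset.mem_union.1 hb).resolve_left hbZ)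
      ((Finset.mem_union.1 hc).resolve_left hcZ) habc

theorem tr_add_tr_le {X A A' : Finset W} (hA : A ⊆ X) (hA' : A' ⊆ X)
    (hadj : ∀ a ∈ A, ∀ b ∈ A', T.Adj a b) : T.tr A + T.tr A' ≤ T.tr X := by
  obtain ⟨Z, hZA, hZ, hZc⟩ := T.exists_isTransitiveOn_card_eq_tr A
  obtain ⟨Z', hZA', hZ', hZc'⟩ := T.exists_isTransitiveOn_card_eq_tr A'
  have hdisj : Disjoint Z Z' := Finset.disjoint_left.2 fun a ha ha' =>
    T.loopless a (hadj a (hZA ha) a (hZA' ha'))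
  rw [← hZc, ← hZc', ← Finset.card_union_of_disjoint hdisj]
  exact (hZ.union hZ' fun a ha b hb => hadj a (hZA ha) b (hZA' hb)).card_le_tr
    (Finset.union_subset (hZA.trans hA) (hZA'.trans hA'))

end TransitiveSets

section Modules

variable {W : Type*} {T : Tournament W} {B N M M' : Finset W} {a b c : W}

/-- `M` is a module (homogeneous set) of `T | B`: no vertex of `B` outside `M` distinguishes two
vertices of `M`. -/
structure IsModule (T : Tournament W) (B M : Finset W) : Prop where
  subset : M ⊆ B
  adj_of_adj : ∀ ⦃v⦄, v ∈ B → v ∉ M → ∀ ⦃a⦄, a ∈ M → ∀ ⦃b⦄, b ∈ M → T.Adj v a → T.Adj v b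

/-- The subtournament induced by `M` is strongly connected, expressed through cuts: every proper
nonempty subset of `M` is entered by an arc from the rest of `M`. -/
def IsStrong (T : Tournament W) (M : Finset W) : Prop :=
  ∀ A ⊂ M, A.Nonempty → ∃ a ∈ A, ∃ b ∈ M \ A, T.Adj b a

/-- Every cyclic triangle of `T | B` with two vertices in `N` has its third vertex in `N`. The
vertices of `N` are not required to lie in `B`. -/
def TriangleClosed (T : Tournament W) (B N : Finset W) : Prop :=
  ∀ ⦃a⦄, a ∈ N → ∀ ⦃b⦄, b ∈ N → ∀ ⦃c⦄, c ∈ B → T.IsCyclicTriangle a b c → c ∈ N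

theorem isModule_singleton (ha : a ∈ B) : T.IsModule B {a} where
  subset := Finset.singleton_subset_iff.2 ha
  adj_of_adj v _ _ p hp q hq h := by
    rw [Finset.mem_singleton] at hp hq
    rwa [hq, ← hp]

theorem isStrong_singleton (T : Tournament W) (a : W) : T.IsStrong {a} := fun _ hA hne =>
  absurd (Finset.ssubset_singleton_iff.1 hA) hne.ne_empty

theorem IsModule.adj_of_adj' (h : T.IsModule B M) {v : W} (hv : v ∈ B) (hvM : v ∉ M)
    (ha : a ∈ M) (hb : b ∈ M) (hav : T.Adj a v) : T.Adj b v :=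
  adj_of_not_adj (fun hvb => hvM (hvb ▸ hb)) fun hvb =>
    adj_asymm hav (h.adj_of_adj hv hvM hb ha hvb)

theorem IsModule.triangleClosed (h : T.IsModule B M) : T.TriangleClosed B M := by
  intro a ha b hb c hc habc
  by_contra hcM
  exact adj_asymm habc.2.1 (h.adj_of_adj hc hcM ha hb habc.2.2)

theorem TriangleClosed.isModule (h : T.TriangleClosed B N) (hNB : N ⊆ B) (hN : T.IsStrong N) :
    T.IsModule B N where
  subset := hNB
  adj_of_adj v hv hvN a ha b hb hva := by
    by_contra hvb
    obtain ⟨p, hp, q, hq, hqp⟩ := hN {x ∈ N | ¬ T.Adj v x}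
      (Finset.filter_ssubset.2 ⟨a, ha, not_not.2 hva⟩) ⟨b, Finset.mem_filter.2 ⟨hb, hvb⟩⟩
    simp only [Finset.mem_sdiff, Finset.mem_filter, not_and, not_not] at hp hq
    have hpv : T.Adj p v := adj_of_not_adj (fun hvp => hvN (hvp ▸ hp.1)) hp.2
    exact hvN (h hq.1 hp.1 hv ⟨hqp, hpv, hq.2 hq.1⟩)

theorem TriangleClosed.of_not_entered {A : Finset W} (h : T.TriangleClosed B N) (hAN : A ⊆ N)
    (hA : ∀ a ∈ A, ∀ b ∈ N \ A, ¬ T.Adj b a) : T.TriangleClosed B A := by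
  intro a ha b hb c hc habc
  by_contra hcA
  exact hA a ha c (Finset.mem_sdiff.2 ⟨h (hAN ha) (hAN hb) hc habc, hcA⟩) habc.2.2

theorem TriangleClosed.sdiff_of_not_entered {A : Finset W} (h : T.TriangleClosed B N)
    (hA : ∀ a ∈ A, ∀ b ∈ N \ A, ¬ T.Adj b a) : T.TriangleClosed B (N \ A) := by
  intro a ha b hb c hc habc
  have hcN : c ∈ N := h (Finset.sdiff_subset ha) (Finset.sdiff_subset hb) hc habc
  exact Finset.mem_sdiff.2 ⟨hcN, fun hcA => hA c hcA b hb habc.2.1⟩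

theorem TriangleClosed.exists_isStrong_isModule (h : T.TriangleClosed B N) (hNB : N ⊆ B)
    (ha : a ∈ N) (hb : b ∈ N) (hc : c ∈ N) (habc : T.IsCyclicTriangle a b c) :
    ∃ M ⊆ N, T.IsStrong M ∧ T.IsModule B M ∧ a ∈ M ∧ b ∈ M ∧ c ∈ M := by
  induction N using Finset.strongInduction with
  | H N ih =>
    by_cases hN : T.IsStrong N
    · exact ⟨N, subset_rfl, hN, h.isModule hNB hN, ha, hb, hc⟩
    simp only [IsStrong, not_forall, not_exists, not_and] at hN
    obtain ⟨A, hAN, hAne, hA⟩ := hN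
    have pred_mem : ∀ p ∈ A, ∀ q ∈ N, T.Adj q p → q ∈ A := fun p hp q hq hqp => by
      by_contra hqA
      exact hA p hp q (Finset.mem_sdiff.2 ⟨hq, hqA⟩) hqp
    by_cases haA : a ∈ A
    · have hcA := pred_mem a haA c hc habc.2.2
      have hbA := pred_mem c hcA b hb habc.2.1
      obtain ⟨M, hM, hM'⟩ := ih A hAN (h.of_not_entered hAN.1 hA) (hAN.1.trans hNB) haA hbA hcA
      exact ⟨M, hM.trans hAN.1, hM'⟩
    · have hbA : b ∉ A := fun hbA => haA (pred_mem b hbA a ha habc.1)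
      have hcA : c ∉ A := fun hcA => hbA (pred_mem c hcA b hb habc.2.1)
      obtain ⟨M, hM, hM'⟩ := ih (N \ A) (Finset.sdiff_ssubset hAN.1 hAne)
        (h.sdiff_of_not_entered hA) (Finset.sdiff_subset.trans hNB)
        (Finset.mem_sdiff.2 ⟨ha, haA⟩) (Finset.mem_sdiff.2 ⟨hb, hbA⟩)
        (Finset.mem_sdiff.2 ⟨hc, hcA⟩)
      exact ⟨M, hM.trans Finset.sdiff_subset, hM'⟩

theorem IsStrong.not_adj_of_overlap (hM : T.IsStrong M) (h : T.IsModule B M)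
    (h' : T.IsModule B M') (hb : b ∈ M) (hb' : b ∈ M') (ha : a ∈ M) (ha' : a ∉ M') (hc : c ∉ M)
    (hc' : c ∈ M') : ¬ T.Adj a c := by
  intro hac
  obtain ⟨p, hp, q, hq, hqp⟩ := hM (M \ M')
    (sdiff_lt_left.2 (Finset.not_disjoint_iff.2 ⟨b, hb', hb⟩))
    ⟨a, Finset.mem_sdiff.2 ⟨ha, ha'⟩⟩
  simp only [Finset.mem_sdiff, not_and, not_not] at hp hq
  have hpc : T.Adj p c := h.adj_of_adj' (h'.subset hc') hc ha hp.1 hac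
  have hpq : T.Adj p q := h'.adj_of_adj (h.subset hp.1) hp.2 hc' (hq.2 hq.1) hpc
  exact adj_asymm hpq hqp

theorem IsStrong.subset_or_subset (hM : T.IsStrong M) (hM' : T.IsStrong M')
    (h : T.IsModule B M) (h' : T.IsModule B M') (hMM' : ¬ Disjoint M M') :
    M ⊆ M' ∨ M' ⊆ M := by
  obtain ⟨b, hb, hb'⟩ := Finset.not_disjoint_iff.1 hMM'
  by_contra! hcon
  obtain ⟨a, ha, ha'⟩ := Finset.not_subset.1 hcon.1
  obtain ⟨c, hc', hc⟩ := Finset.not_subset.1 hcon.2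
  have hac := hM.not_adj_of_overlap h h' hb hb' ha ha' hc hc'
  have hca := hM'.not_adj_of_overlap h' h hb' hb hc' hc ha' ha
  exact hca (adj_of_not_adj (fun hac => hc (hac ▸ ha)) hac)

/-- Every cyclic triangle with vertices in `Z` lies in one part of `P`. When the parts are modules,
this says that contracting each part to a vertex makes `Z` transitive. -/
def IsTransitiveMod (T : Tournament W) (P : Finpartition B) (Z : Finset W) : Prop :=
  ∀ ⦃a⦄, a ∈ Z → ∀ ⦃b⦄, b ∈ Z → ∀ ⦃c⦄, c ∈ Z → T.IsCyclicTriangle a b c →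
    ∃ M ∈ P.parts, a ∈ M ∧ b ∈ M ∧ c ∈ M

theorem IsTransitiveOn.isTransitiveMod {P : Finpartition B} {Z : Finset W}
    (h : T.IsTransitiveOn Z) : T.IsTransitiveMod P Z :=
  fun _ ha _ hb _ hc habc => absurd habc (h ha hb hc)

theorem exists_finpartition_isModule {ι : Type*} {Y : Finset ι} {N : ι → Finset W}
    (hNB : ∀ y ∈ Y, N y ⊆ B) (hN : ∀ y ∈ Y, T.TriangleClosed B (N y)) :
    ∃ P : Finpartition B, (∀ M ∈ P.parts, T.IsModule B M) ∧
      (∀ M ∈ P.parts, #M ≤ 1 ∨ ∃ y ∈ Y, M ⊆ N y) ∧ ∀ y ∈ Y, T.IsTransitiveMod P (N y) := by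
  obtain ⟨P, hPF, hFP⟩ := exists_finpartition_of_laminar
    (F := {M | M.Nonempty ∧ T.IsStrong M ∧ T.IsModule B M ∧ (#M ≤ 1 ∨ ∃ y ∈ Y, M ⊆ N y)})
    (fun M hM => hM.1) (fun M hM => hM.2.2.1.subset)
    (fun M hM M' hM' => hM.2.1.subset_or_subset hM'.2.1 hM.2.2.1 hM'.2.2.1)
    fun a ha => ⟨{a}, ⟨Finset.singleton_nonempty a, T.isStrong_singleton a, isModule_singleton ha,
      .inl (Finset.card_singleton a).le⟩, Finset.mem_singleton_self a⟩
  refine ⟨P, fun M hM => (hPF M hM).2.2.1, fun M hM => (hPF M hM).2.2.2, ?_⟩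
  intro y hy a ha b hb c hc habc
  obtain ⟨M, hMN, hM, hMB, haM, hbM, hcM⟩ :=
    (hN y hy).exists_isStrong_isModule (hNB y hy) ha hb hc habc
  obtain ⟨M', hM', hMM'⟩ := hFP M ⟨⟨a, haM⟩, hM, hMB, .inr ⟨y, hy, hMN⟩⟩
  exact ⟨M', hM', hMM' haM, hMM' hbM, hMM' hcM⟩

end Modules

section ModularPartitions

variable {W : Type*} {T : Tournament W} {B : Finset W} {P : Finpartition B}

theorem adj_of_adj_of_mem_parts (hP : ∀ M ∈ P.parts, T.IsModule B M) {M M' : Finset W}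
    (hM : M ∈ P.parts) (hM' : M' ∈ P.parts) (hMM' : M ≠ M') {a a' b b' : W} (ha : a ∈ M)
    (ha' : a' ∈ M) (hb : b ∈ M') (hb' : b' ∈ M') (hab : T.Adj a b) : T.Adj a' b' := by
  have hdisj := P.disjoint hM hM' hMM'
  have haM' : a ∉ M' := Finset.disjoint_left.1 hdisj ha
  have hbM : b' ∉ M := Finset.disjoint_right.1 hdisj hb'
  exact (hP M hM).adj_of_adj' (P.subset hM' hb') hbM ha ha'
    ((hP M' hM').adj_of_adj (P.subset hM ha) haM' hb hb' hab)

theorem IsTransitiveMod.of_parts_meeting (hP : ∀ M ∈ P.parts, T.IsModule B M) {Z Z' : Finset W}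
    (hZ : T.IsTransitiveMod P Z) (hZ' : ∀ a ∈ Z', ∃ M ∈ P.parts, a ∈ M ∧ ¬ Disjoint M Z) :
    T.IsTransitiveMod P Z' := by
  intro a ha b hb c hc habc
  obtain ⟨Ma, hMa, haMa, hZa⟩ := hZ' a ha
  obtain ⟨Mb, hMb, hbMb, hZb⟩ := hZ' b hb
  obtain ⟨Mc, hMc, hcMc, hZc⟩ := hZ' c hc
  rcases eq_or_ne Ma Mb with rfl | hab
  · exact ⟨Ma, hMa, haMa, hbMb, (hP Ma hMa).triangleClosed haMa hbMb (P.subset hMc hcMc) habc⟩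
  rcases eq_or_ne Mb Mc with rfl | hbc
  · exact ⟨Mb, hMb, (hP Mb hMb).triangleClosed hbMb hcMc (P.subset hMa haMa) habc.rotate,
      hbMb, hcMc⟩
  rcases eq_or_ne Mc Ma with rfl | hca
  · exact ⟨Mc, hMc, haMa, (hP Mc hMc).triangleClosed hcMc haMa (P.subset hMb hbMb)
      habc.rotate.rotate, hcMc⟩
  obtain ⟨a', ha', haZ⟩ := Finset.not_disjoint_iff.1 hZa
  obtain ⟨b', hb', hbZ⟩ := Finset.not_disjoint_iff.1 hZb
  obtain ⟨c', hc', hcZ⟩ := Finset.not_disjoint_iff.1 hZc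
  obtain ⟨M, hM, haM, hbM, -⟩ := hZ haZ hbZ hcZ
    ⟨adj_of_adj_of_mem_parts hP hMa hMb hab haMa ha' hbMb hb' habc.1,
      adj_of_adj_of_mem_parts hP hMb hMc hbc hbMb hb' hcMc hc' habc.2.1,
      adj_of_adj_of_mem_parts hP hMc hMa hca hcMc hc' haMa ha' habc.2.2⟩
  exact absurd ((P.eq_of_mem_parts hMa hM ha' haM).trans (P.eq_of_mem_parts hM hMb hbM hb')) hab

theorem IsTransitiveMod.sum_tr_le_tr (hP : ∀ M ∈ P.parts, T.IsModule B M) {Z : Finset W}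
    (hZ : T.IsTransitiveMod P Z) : ∑ M ∈ P.parts with ¬ Disjoint M Z, T.tr M ≤ T.tr B := by
  choose t ht htrans hcard using T.exists_isTransitiveOn_card_eq_tr
  set Q := {M ∈ P.parts | ¬ Disjoint M Z}
  have hdisj : (Q : Set (Finset W)).PairwiseDisjoint t := fun M hM M' hM' hMM' =>
    (P.disjoint (Finset.mem_filter.1 hM).1 (Finset.mem_filter.1 hM').1 hMM').mono (ht M) (ht M')
  have mem_part : ∀ a ∈ Q.biUnion t, ∃ M ∈ P.parts, a ∈ M ∧ ¬ Disjoint M Z := fun a ha => by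
    obtain ⟨M, hM, haM⟩ := Finset.mem_biUnion.1 ha
    exact ⟨M, (Finset.mem_filter.1 hM).1, ht M haM, (Finset.mem_filter.1 hM).2⟩
  have mem_of_mem : ∀ M ∈ P.parts, ∀ a ∈ M, a ∈ Q.biUnion t → a ∈ t M := fun M hM a haM ha => by
    obtain ⟨M', hM', haM'⟩ := Finset.mem_biUnion.1 ha
    rwa [P.eq_of_mem_parts hM (Finset.mem_filter.1 hM').1 haM (ht M' haM')]
  have htrans_union : T.IsTransitiveOn (Q.biUnion t) := fun a ha b hb c hc habc => by
    obtain ⟨M, hM, haM, hbM, hcM⟩ := hZ.of_parts_meeting hP mem_part ha hb hc habc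
    exact htrans M (mem_of_mem M hM a haM ha) (mem_of_mem M hM b hbM hb)
      (mem_of_mem M hM c hcM hc) habc
  calc ∑ M ∈ Q, T.tr M = #(Q.biUnion t) := by simp only [Finset.card_biUnion hdisj, hcard]
    _ ≤ T.tr B := htrans_union.card_le_tr
      (Finset.biUnion_subset.2 fun M hM => (ht M).trans (P.subset (Finset.mem_filter.1 hM).1))

variable {ι : Type*} {Y : Finset ι} {N : ι → Finset W}

theorem sum_card_mul_tr_le (hP : ∀ M ∈ P.parts, T.IsModule B M)
    (hN : ∀ y ∈ Y, T.IsTransitiveMod P (N y)) :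
    ∑ M ∈ P.parts, #{y ∈ Y | ¬ Disjoint M (N y)} * T.tr M ≤ #Y * T.tr B :=
  calc ∑ M ∈ P.parts, #{y ∈ Y | ¬ Disjoint M (N y)} * T.tr M
      = ∑ y ∈ Y, ∑ M ∈ P.parts with ¬ Disjoint M (N y), T.tr M := by
        simp only [Finset.card_filter, Finset.sum_mul, Finset.sum_filter, ite_mul, one_mul,
          zero_mul]
        exact Finset.sum_comm
    _ ≤ ∑ _y ∈ Y, T.tr B := Finset.sum_le_sum fun y hy => (hN y hy).sum_tr_le_tr hP
    _ = #Y * T.tr B := by rw [Finset.sum_const, smul_eq_mul]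

/-- The parts `M` of `P` such that the proportion of the sets `N y`, `y ∈ Y`, that meet `M` exceeds
half of `tr M / tr B`. -/
noncomputable def heavyParts (T : Tournament W) (P : Finpartition B) (Y : Finset ι)
    (N : ι → Finset W) : Finset (Finset W) :=
  {M ∈ P.parts | #Y * T.tr M < 2 * T.tr B * #{y ∈ Y | ¬ Disjoint M (N y)}}

theorem sum_heavyParts_sq_tr_le (hP : ∀ M ∈ P.parts, T.IsModule B M)
    (hN : ∀ y ∈ Y, T.IsTransitiveMod P (N y)) (hY : Y.Nonempty) :
    ∑ M ∈ heavyParts T P Y N, T.tr M ^ 2 ≤ 2 * T.tr B ^ 2 := by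
  refine Nat.le_of_mul_le_mul_left ?_ hY.card_pos
  calc #Y * ∑ M ∈ heavyParts T P Y N, T.tr M ^ 2
      = ∑ M ∈ heavyParts T P Y N, #Y * T.tr M * T.tr M := by
        rw [Finset.mul_sum]
        exact Finset.sum_congr rfl fun M _ => by ring
    _ ≤ ∑ M ∈ heavyParts T P Y N, 2 * T.tr B * #{y ∈ Y | ¬ Disjoint M (N y)} * T.tr M :=
        Finset.sum_le_sum fun M hM => Nat.mul_le_mul_right _ (Finset.mem_filter.1 hM).2.le
    _ ≤ ∑ M ∈ P.parts, 2 * T.tr B * #{y ∈ Y | ¬ Disjoint M (N y)} * T.tr M :=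
        Finset.sum_le_sum_of_subset (Finset.filter_subset _ _)
    _ = 2 * T.tr B * ∑ M ∈ P.parts, #{y ∈ Y | ¬ Disjoint M (N y)} * T.tr M := by
        simp only [Finset.mul_sum, mul_assoc]
    _ ≤ 2 * T.tr B * (#Y * T.tr B) := Nat.mul_le_mul_left _ (sum_card_mul_tr_le hP hN)
    _ = #Y * (2 * T.tr B ^ 2) := by ring

theorem two_mul_card_not_disjoint_le (hP : ∀ M ∈ P.parts, T.IsModule B M) {Z : Finset W}
    (hZB : Z ⊆ B) (hZ : T.IsTransitiveMod P Z) (hB : B.Nonempty)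
    (hlight : ∀ M ∈ P.parts, ¬ Disjoint M Z → M ∉ heavyParts T P Y N) :
    2 * #{y ∈ Y | ¬ Disjoint Z (N y)} ≤ #Y := by
  set Q := {M ∈ P.parts | ¬ Disjoint M Z}
  have hsub : {y ∈ Y | ¬ Disjoint Z (N y)} ⊆ Q.biUnion fun M => {y ∈ Y | ¬ Disjoint M (N y)} := by
    intro y hy
    obtain ⟨hyY, hdisj⟩ := Finset.mem_filter.1 hy
    obtain ⟨a, haZ, haN⟩ := Finset.not_disjoint_iff.1 hdisj
    obtain ⟨M, hM, haM⟩ := P.exists_mem (hZB haZ)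
    exact Finset.mem_biUnion.2 ⟨M,
      Finset.mem_filter.2 ⟨hM, Finset.not_disjoint_iff.2 ⟨a, haM, haZ⟩⟩,
      Finset.mem_filter.2 ⟨hyY, Finset.not_disjoint_iff.2 ⟨a, haM, haN⟩⟩⟩
  have hlight' : ∀ M ∈ Q, 2 * T.tr B * #{y ∈ Y | ¬ Disjoint M (N y)} ≤ #Y * T.tr M :=
    fun M hM => by
      obtain ⟨hMP, hMZ⟩ := Finset.mem_filter.1 hM
      exact not_lt.1 fun h => hlight M hMP hMZ (Finset.mem_filter.2 ⟨hMP, h⟩)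
  refine Nat.le_of_mul_le_mul_left ?_ (tr_pos (T := T) hB)
  calc T.tr B * (2 * #{y ∈ Y | ¬ Disjoint Z (N y)})
      = 2 * T.tr B * #{y ∈ Y | ¬ Disjoint Z (N y)} := by ring
    _ ≤ 2 * T.tr B * ∑ M ∈ Q, #{y ∈ Y | ¬ Disjoint M (N y)} :=
        Nat.mul_le_mul_left _ ((Finset.card_le_card hsub).trans Finset.card_biUnion_le)
    _ ≤ ∑ M ∈ Q, #Y * T.tr M := by
        rw [Finset.mul_sum]
        exact Finset.sum_le_sum hlight'
    _ ≤ T.tr B * #Y := by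
        rw [← Finset.mul_sum, mul_comm]
        exact Nat.mul_le_mul_right _ (hZ.sum_tr_le_tr hP)

theorem exists_subset_forall_card_le_of_heavyParts (hP : ∀ M ∈ P.parts, T.IsModule B M)
    (hB : B.Nonempty) (hheavy : 2 * ∑ M ∈ heavyParts T P Y N, #M ≤ #B) :
    ∃ G ⊆ B, #B ≤ 2 * #G ∧
      ∀ Z ⊆ G, T.IsTransitiveMod P Z → #Y ≤ 2 * #{y ∈ Y | Disjoint Z (N y)} := by
  have hsub : heavyParts T P Y N ⊆ P.parts := Finset.filter_subset _ _
  set L := P.parts \ heavyParts T P Y N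
  have hLP : L ⊆ P.parts := Finset.sdiff_subset
  have hLB : L.biUnion id ⊆ B := Finset.biUnion_subset.2 fun M hM => P.subset (hLP hM)
  refine ⟨L.biUnion id, hLB, ?_, fun Z hZ htrans => ?_⟩
  · have hL : #(L.biUnion id) = ∑ M ∈ L, #M :=
      Finset.card_biUnion fun M hM M' hM' => P.disjoint (hLP hM) (hLP hM')
    have : ∑ M ∈ L, #M + ∑ M ∈ heavyParts T P Y N, #M = #B :=
      (Finset.sum_sdiff hsub).trans P.sum_card_parts
    omega
  · have hlight : ∀ M ∈ P.parts, ¬ Disjoint M Z → M ∉ heavyParts T P Y N := by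
      intro M hM hMZ
      obtain ⟨a, haM, haZ⟩ := Finset.not_disjoint_iff.1 hMZ
      obtain ⟨M', hM', haM'⟩ := Finset.mem_biUnion.1 (hZ haZ)
      rw [P.eq_of_mem_parts hM (hLP hM') haM haM']
      exact (Finset.mem_sdiff.1 hM').2
    have hhit := two_mul_card_not_disjoint_le hP (hZ.trans hLB) htrans hB hlight
    have := Finset.card_filter_add_card_filter_not (s := Y) fun y => Disjoint Z (N y)
    omega

end ModularPartitions

section CriticalSets

variable {W : Type*} {T : Tournament W} {ε K : ℝ} {X B : Finset W}

/-- `X` induces a minimal counterexample, among the subtournaments of `T`, to the lower bound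
`n ^ ε` on the largest size of a transitive subtournament. -/
structure IsCritical (T : Tournament W) (ε : ℝ) (X : Finset W) : Prop where
  tr_lt : (T.tr X : ℝ) < (#X : ℝ) ^ ε
  le_tr : ∀ A ⊂ X, (#A : ℝ) ^ ε ≤ T.tr A

theorem exists_isCritical [Fintype W] (h : (T.tr Finset.univ : ℝ) < (Fintype.card W : ℝ) ^ ε) :
    ∃ X, T.IsCritical ε X := by
  obtain ⟨X, hX⟩ := exists_minimal_of_wellFoundedLT
    (fun X : Finset W => (T.tr X : ℝ) < (#X : ℝ) ^ ε) ⟨Finset.univ, h⟩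
  exact ⟨X, hX.prop, fun A hA => not_lt.1 (hX.not_prop_of_lt hA)⟩

theorem satisfiesEHC_of_forall_not_isCritical {V : Type u} {H : Tournament V} (hε : 0 < ε)
    (h : ∀ (W : Type v) [Fintype W] (T : Tournament W) (X : Finset W),
      ¬ T.Contains H → ¬ T.IsCritical ε X) : SatisfiesEHC.{u, v} H := by
  refine ⟨ε, hε, fun W _ T hT => ?_⟩
  obtain ⟨Z, -, hZ, hZc⟩ := T.exists_isTransitiveOn_card_eq_tr Finset.univ
  refine ⟨Z, hZ.isTransitive_induce, ?_⟩
  by_contra! hlt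
  obtain ⟨X, hX⟩ := exists_isCritical (hZc ▸ hlt)
  exact h W T X hT hX

theorem IsCritical.two_lt_card (hX : T.IsCritical ε X) (hε : 0 < ε) (hε1 : ε ≤ 1) : 2 < #X := by
  by_contra! hle
  refine hX.tr_lt.not_ge ?_
  calc (#X : ℝ) ^ ε ≤ #X := by
        rcases X.eq_empty_or_nonempty with rfl | hne
        · simp [Real.zero_rpow hε.ne']
        · exact Real.rpow_le_self_of_one_le (by exact_mod_cast hne.card_pos) hε1
    _ ≤ T.tr X := by exact_mod_cast (isTransitiveOn_of_card_le_two hle).card_le_tr subset_rfl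

theorem IsCritical.le_card (hX : T.IsCritical ε X) (hε : 0 < ε) (hε1 : ε ≤ 1)
    (hK : K ^ ε ≤ 2) : K ≤ #X := by
  by_contra! hlt
  obtain ⟨A, hAX, hA⟩ := Finset.exists_subset_card_eq (hX.two_lt_card hε hε1).le
  have htr : 2 ≤ T.tr X := hA ▸ (isTransitiveOn_of_card_le_two hA.le).card_le_tr hAX
  have hlt2 : (T.tr X : ℝ) < 2 := calc
    (T.tr X : ℝ) < (#X : ℝ) ^ ε := hX.tr_lt
    _ ≤ K ^ ε := by gcongr
    _ ≤ 2 := hK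
  exact hlt2.not_ge (by exact_mod_cast htr)

theorem IsCritical.rpow_le_two_mul_tr (hX : T.IsCritical ε X) (hε : 0 < ε) (hK0 : 0 < K)
    (hK : K ^ ε ≤ 2) {A : Finset W} (hA : A ⊂ X) (hXA : (#X : ℝ) ≤ K * #A) :
    (#X : ℝ) ^ ε ≤ 2 * T.tr A :=
  calc (#X : ℝ) ^ ε ≤ (K * #A) ^ ε := by gcongr
    _ = K ^ ε * (#A : ℝ) ^ ε := Real.mul_rpow hK0.le (Nat.cast_nonneg _)
    _ ≤ 2 * T.tr A := mul_le_mul hK (hX.le_tr A hA) (by positivity) zero_le_two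

theorem IsCritical.card_le_rpow_mul_sq_tr (hX : T.IsCritical ε X) (hε : 0 < ε)
    (hε2 : 2 * ε ≤ 1) {A : Finset W} (hA : A ⊂ X) {t : ℝ} (hAt : (#A : ℝ) ≤ t) :
    (#A : ℝ) ≤ t ^ (1 - 2 * ε) * (T.tr A : ℝ) ^ 2 := by
  have ht : 0 ≤ t := (Nat.cast_nonneg _).trans hAt
  have hexp : 0 ≤ 1 - 2 * ε := by linarith
  calc (#A : ℝ) = (#A : ℝ) ^ (1 - 2 * ε) * (#A : ℝ) ^ (2 * ε) := by
        rw [← Real.rpow_add_of_nonneg (Nat.cast_nonneg _) hexp (by positivity), sub_add_cancel,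
          Real.rpow_one]
    _ = (#A : ℝ) ^ (1 - 2 * ε) * ((#A : ℝ) ^ ε) ^ 2 := by
        rw [mul_comm 2 ε, Real.rpow_mul (Nat.cast_nonneg _), Real.rpow_two]
    _ ≤ t ^ (1 - 2 * ε) * (T.tr A : ℝ) ^ 2 := by
        gcongr
        exact hX.le_tr A hA

theorem IsCritical.sq_tr_le_two_mul_rpow (hX : T.IsCritical ε X) (hε : 0 < ε) (hK0 : 0 < K)
    (hK : K ^ (2 * ε) ≤ 2) (hBX : B ⊆ X) {t : ℝ} (ht : 0 ≤ t) (hXt : (#X : ℝ) ≤ K * t) :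
    (T.tr B : ℝ) ^ 2 ≤ 2 * t ^ (2 * ε) :=
  calc (T.tr B : ℝ) ^ 2 ≤ ((#X : ℝ) ^ ε) ^ 2 := by
        gcongr
        exact (Nat.cast_le.2 (tr_mono hBX)).trans hX.tr_lt.le
    _ = (#X : ℝ) ^ (2 * ε) := by
        rw [mul_comm 2 ε, Real.rpow_mul (Nat.cast_nonneg _), Real.rpow_two]
    _ ≤ (K * t) ^ (2 * ε) := by gcongr
    _ = K ^ (2 * ε) * t ^ (2 * ε) := Real.mul_rpow hK0.le ht
    _ ≤ 2 * t ^ (2 * ε) := by gcongr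

theorem IsCritical.sum_card_heavyParts_le (hX : T.IsCritical ε X) (hε : 0 < ε) (hε2 : 2 * ε ≤ 1)
    (hK0 : 0 < K) (hK : K ^ (2 * ε) ≤ 2) (hBX : B ⊂ X) (hXB : 8 * (#X : ℝ) ≤ K * #B)
    {P : Finpartition B} (hP : ∀ M ∈ P.parts, T.IsModule B M)
    (hPB : ∀ M ∈ P.parts, 8 * #M ≤ #B) {ι : Type*} {Y : Finset ι} (hY : Y.Nonempty)
    {N : ι → Finset W} (hN : ∀ y ∈ Y, T.IsTransitiveMod P (N y)) :
    2 * ∑ M ∈ heavyParts T P Y N, #M ≤ #B := by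
  set b : ℝ := #B / 8 with hb
  -- Splitting `#M = #M ^ (1 - 2 * ε) * (#M ^ ε) ^ 2` turns the bound on the sum of the squares of
  -- the transitive numbers of the heavy parts into a bound on the sum of their sizes.
  have hMb : ∀ M ∈ heavyParts T P Y N, (#M : ℝ) ≤ b ^ (1 - 2 * ε) * (T.tr M : ℝ) ^ 2 :=
    fun M hM => by
      have hMP : M ∈ P.parts := (Finset.mem_filter.1 hM).1
      refine hX.card_le_rpow_mul_sq_tr hε hε2 ((P.subset hMP).trans_ssubset hBX) ?_
      rw [hb, le_div_iff₀' (by norm_num)]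
      exact_mod_cast hPB M hMP
  have hsq : (∑ M ∈ heavyParts T P Y N, (T.tr M : ℝ) ^ 2) ≤ 2 * (T.tr B : ℝ) ^ 2 := by
    exact_mod_cast sum_heavyParts_sq_tr_le hP hN hY
  have htrB : (T.tr B : ℝ) ^ 2 ≤ 2 * b ^ (2 * ε) :=
    hX.sq_tr_le_two_mul_rpow hε hK0 hK hBX.1 (by positivity) (by rw [hb]; linarith)
  have hsum : ∑ M ∈ heavyParts T P Y N, (#M : ℝ) ≤ 4 * b := calc
    ∑ M ∈ heavyParts T P Y N, (#M : ℝ)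
        ≤ b ^ (1 - 2 * ε) * ∑ M ∈ heavyParts T P Y N, (T.tr M : ℝ) ^ 2 := by
          rw [Finset.mul_sum]
          exact Finset.sum_le_sum hMb
    _ ≤ b ^ (1 - 2 * ε) * (2 * (2 * b ^ (2 * ε))) := by gcongr; linarith
    _ = 4 * (b ^ (1 - 2 * ε) * b ^ (2 * ε)) := by ring
    _ = 4 * b := by
        rw [← Real.rpow_add_of_nonneg (by positivity) (by linarith) (by positivity),
          sub_add_cancel, Real.rpow_one]
  have : 2 * ∑ M ∈ heavyParts T P Y N, (#M : ℝ) ≤ #B := by linarith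
  exact_mod_cast this

theorem IsCritical.exists_not_adj (hX : T.IsCritical ε X) {A A' : Finset W} (hA : A ⊆ X)
    (hA' : A' ⊆ X) (htr : (#X : ℝ) ^ ε ≤ 2 * T.tr A) (htr' : (#X : ℝ) ^ ε ≤ 2 * T.tr A') :
    ∃ a ∈ A, ∃ a' ∈ A', ¬ T.Adj a a' := by
  by_contra! hadj
  have hsum : (T.tr A : ℝ) + T.tr A' ≤ T.tr X := by exact_mod_cast tr_add_tr_le hA hA' hadj
  linarith [hX.tr_lt]

theorem IsCritical.eight_le_card (hX : T.IsCritical ε X) (hε : 0 < ε) (hε2 : 2 * ε ≤ 1)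
    (hK0 : 0 < K) (hK : K ^ (2 * ε) ≤ 2) (hXB : 8 * (#X : ℝ) ≤ K * #B) : 8 ≤ #B := by
  have hKX : K ≤ #X := hX.le_card hε (by linarith) (rpow_le_two_of_rpow_two_mul_le hK0.le hK)
  exact_mod_cast (show (8 : ℝ) ≤ #B by nlinarith)

theorem IsCritical.exists_subset_forall_card_le (hX : T.IsCritical ε X) (hε : 0 < ε)
    (hε2 : 2 * ε ≤ 1) (hK0 : 0 < K) (hK : K ^ (2 * ε) ≤ 2) (hBX : B ⊂ X)
    (hXB : 8 * (#X : ℝ) ≤ K * #B) {ι : Type*} {Y : Finset ι} (hY : Y.Nonempty)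
    {N : ι → Finset W} (hNB : ∀ y ∈ Y, N y ⊆ B) (hclosed : ∀ y ∈ Y, T.TriangleClosed B (N y))
    (hNcard : ∀ y ∈ Y, 8 * #(N y) ≤ #B) :
    ∃ G ⊆ B, #B ≤ 2 * #G ∧
      ∀ Z ⊆ G, T.IsTransitiveOn Z → #Y ≤ 2 * #{y ∈ Y | Disjoint Z (N y)} := by
  have hB8 : 8 ≤ #B := hX.eight_le_card hε hε2 hK0 hK hXB
  obtain ⟨P, hP, hPN, hN⟩ := exists_finpartition_isModule hNB hclosed
  have hPB : ∀ M ∈ P.parts, 8 * #M ≤ #B := fun M hM => by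
    rcases hPN M hM with h1 | ⟨y, hy, hMy⟩
    · omega
    · exact (Nat.mul_le_mul_left 8 (Finset.card_le_card hMy)).trans (hNcard y hy)
  obtain ⟨G, hGB, hGcard, hG⟩ := exists_subset_forall_card_le_of_heavyParts hP
    (Finset.card_pos.1 (by omega)) (hX.sum_card_heavyParts_le hε hε2 hK0 hK hBX hXB hP hPB hY hN)
  exact ⟨G, hGB, hGcard, fun Z hZG hZ => hG Z hZG hZ.isTransitiveMod⟩

theorem IsCritical.exists_not_triangleClosed (hX : T.IsCritical ε X) (hε : 0 < ε)
    (hε2 : 2 * ε ≤ 1) (hK0 : 0 < K) (hK : K ^ (2 * ε) ≤ 2) (hBX : B ⊆ X) {Y : Finset W}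
    (hYX : Y ⊆ X) (hBY : Disjoint B Y) (hXB : 8 * (#X : ℝ) ≤ K * #B)
    (hXY : 8 * (#X : ℝ) ≤ K * #Y) (hout : ∀ y ∈ Y, 8 * #{w ∈ B | T.Adj y w} ≤ #B) :
    ∃ y ∈ Y, ¬ T.TriangleClosed B {w ∈ B | T.Adj y w} := by
  by_contra! hclosed
  have hB : B.Nonempty := Finset.card_pos.1 (by
    linarith [hX.eight_le_card hε hε2 hK0 hK hXB])
  have hY : Y.Nonempty := Finset.card_pos.1 (by
    linarith [hX.eight_le_card hε hε2 hK0 hK hXY])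
  have hBX' : B ⊂ X := ssubset_of_subset_of_disjoint hBX hYX hY hBY
  have hYX' : Y ⊂ X := ssubset_of_subset_of_disjoint hYX hBX hB hBY.symm
  obtain ⟨G, hGB, hGcard, hG⟩ := hX.exists_subset_forall_card_le hε hε2 hK0 hK hBX' hXB hY
    (fun y _ => Finset.filter_subset (T.Adj y) B) hclosed hout
  obtain ⟨Z, hZG, hZ, hZcard⟩ := T.exists_isTransitiveOn_card_eq_tr G
  set Y' := {y ∈ Y | Disjoint Z {w ∈ B | T.Adj y w}}
  have hY'Y : Y' ⊆ Y := Finset.filter_subset _ _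
  have large_of_half : ∀ A ⊂ X, 8 * (#X : ℝ) ≤ K * #A → ∀ A' ⊆ A, #A ≤ 2 * #A' →
      (#X : ℝ) ^ ε ≤ 2 * T.tr A' := fun A hA hXA A' hA' hAA' => by
    have hAA' : (#A : ℝ) ≤ 2 * #A' := by exact_mod_cast hAA'
    exact hX.rpow_le_two_mul_tr hε hK0 (rpow_le_two_of_rpow_two_mul_le hK0.le hK)
      (hA'.trans_ssubset hA) (by nlinarith)
  have htrZ : T.tr G ≤ T.tr Z := hZcard ▸ hZ.card_le_tr subset_rfl
  obtain ⟨z, hz, y, hy, hzy⟩ := hX.exists_not_adj (hZG.trans (hGB.trans hBX)) (hY'Y.trans hYX)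
    ((large_of_half B hBX' hXB G hGB hGcard).trans (by gcongr))
    (large_of_half Y hYX' hXY Y' hY'Y (hG Z hZG hZ))
  have hzB : z ∈ B := hGB (hZG hz)
  have hyz : T.Adj y z := adj_of_not_adj
    (fun h => Finset.disjoint_left.1 hBY hzB (h ▸ hY'Y hy)) hzy
  exact Finset.disjoint_left.1 (Finset.mem_filter.1 hy).2 hz (Finset.mem_filter.2 ⟨hzB, hyz⟩)

theorem boat_adj_imp_of_arcs {x u v y : W} (hyx : T.Adj y x) (hyu : T.Adj y u) (hvx : T.Adj v x)
    (hxu : T.Adj x u) (huv : T.Adj u v) (hvy : T.Adj v y) (a b : Fin 4) (hab : boat.Adj a b) :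
    T.Adj (![x, u, v, y] a) (![x, u, v, y] b) := by
  rcases hab with h | h | h | h | h | h <;> obtain ⟨rfl, rfl⟩ := Prod.mk.inj h <;> assumption

theorem IsCritical.exists_boat (hX : T.IsCritical ε X) (hε : 0 < ε)
    (hε2 : 2 * ε ≤ 1) (hK0 : 0 < K) (hK : K ^ (2 * ε) ≤ 2) (hBX : B ⊆ X) {Y : Finset W}
    (hYX : Y ⊆ X) (hBY : Disjoint B Y) (hXB : 8 * (#X : ℝ) ≤ K * #B)
    (hXY : 8 * (#X : ℝ) ≤ K * #Y) (hout : ∀ y ∈ Y, 8 * #{w ∈ B | T.Adj y w} ≤ #B) :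
    ∃ ψ : Fin 4 → W, (∀ a, ψ a ∈ (![B, B, B, Y] : Fin 4 → Finset W) a) ∧
      ∀ a b, boat.Adj a b → T.Adj (ψ a) (ψ b) := by
  obtain ⟨y, hy, hclosed⟩ := hX.exists_not_triangleClosed hε hε2 hK0 hK hBX hYX hBY hXB hXY hout
  simp only [TriangleClosed, not_forall] at hclosed
  obtain ⟨x, hx, u, hu, v, hv, ⟨hxu, huv, hvx⟩, hvN⟩ := hclosed
  rw [Finset.mem_filter] at hx hu
  have hvy : T.Adj v y := adj_of_not_adj
    (fun h => Finset.disjoint_left.1 hBY hv (h ▸ hy)) fun h => hvN (Finset.mem_filter.2 ⟨hv, h⟩)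
  refine ⟨![x, u, v, y], ?_, boat_adj_imp_of_arcs hx.2 hu.2 hvx hxu huv hvy⟩
  simpa [Fin.forall_fin_succ] using ⟨hx.1, hu.1, hv, hy⟩

end CriticalSets

section Embedding

variable {V : Type u} {W : Type v} {T : Tournament W} {H : Tournament V} {δ : ℝ}

theorem contains_of_forall_adj {φ : V → W} (hφ : ∀ a b, H.Adj a b → T.Adj (φ a) (φ b)) :
    T.Contains H := by
  have hinj : Function.Injective φ := by
    intro a b hab
    by_contra hne
    by_cases h : H.Adj a b
    · exact ne_of_adj (hφ a b h) hab
    · exact ne_of_adj (hφ b a (adj_of_not_adj hne h)) hab.symm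
  refine ⟨Set.range φ, Equiv.ofInjective φ hinj, fun a b => ⟨hφ a b, fun h => ?_⟩⟩
  by_contra hab
  have hne : a ≠ b := fun e => T.loopless _ (e ▸ h)
  exact adj_asymm h (hφ b a (adj_of_not_adj hne hab))

theorem exists_isSparsePair_of_not_contains [Finite V] (H : Tournament V) (hδ : 0 < δ) :
    ∃ c : ℝ, 0 < c ∧ ∃ N : ℕ, ∀ {W : Type v} (T : Tournament W) (X : Finset W),
      ¬ T.Contains H → N ≤ #X → ∃ A ⊆ X, ∃ B ⊆ X, Disjoint A B ∧
        c * #X ≤ #A ∧ c * #X ≤ #B ∧ IsSparsePair T.Adj δ A B := by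
  obtain ⟨h, ⟨θ⟩⟩ := Finite.exists_equiv_fin V
  obtain ⟨c, hc, hsparse⟩ := exists_transversal_or_isSparsePair.{v} hδ h
  refine ⟨c * (1 / (2 * h + 1)), by positivity, h + 1, fun T X hT hX => ?_⟩
  obtain ⟨S, hSX, hS, hScard⟩ := exists_pairwise_disjoint_subsets ((Nat.le_succ h).trans hX)
  have hX0 : (0 : ℝ) < #X := by exact_mod_cast Nat.lt_of_lt_of_le h.succ_pos hX
  have hScard' (i : Fin h) : 1 / (2 * h + 1) * (#X : ℝ) ≤ #(S i) := by
    rw [one_div, inv_mul_le_iff₀ (by positivity)]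
    exact_mod_cast (hScard i).trans (Nat.mul_le_mul_right _ (Nat.le_succ _))
  rcases hsparse (fun i j a b => if H.Adj (θ.symm i) (θ.symm j) then T.Adj a b else T.Adj b a) S
    _ (by positivity) hScard' with ⟨φ, -, hφ⟩ | ⟨i, j, hij, A, hA, B, hB, hAcard, hBcard, hAB⟩
  · refine absurd (contains_of_forall_adj (φ := φ ∘ θ) fun a b hab => ?_) hT
    rcases lt_trichotomy (θ a) (θ b) with hlt | heq | hgt
    · simpa [hab] using hφ _ _ hlt
    · exact absurd (θ.injective heq) (ne_of_adj hab)
    · simpa [adj_asymm hab] using hφ _ _ hgt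
  · have hdisj : Disjoint A B := Finset.disjoint_of_subset_left hA
      (Finset.disjoint_of_subset_right hB (hS hij.ne))
    rw [← mul_assoc] at hAcard hBcard
    by_cases hH : H.Adj (θ.symm i) (θ.symm j)
    · simp only [hH, if_true] at hAB
      exact ⟨A, hA.trans (hSX i), B, hB.trans (hSX j), hdisj, hAcard, hBcard, hAB⟩
    · simp only [hH, if_false] at hAB
      exact ⟨B, hB.trans (hSX j), A, hA.trans (hSX i), hdisj.symm, hBcard, hAcard, hAB.swap⟩

theorem exists_sparse_sequence [Finite V] (H : Tournament V) (hδ : 0 < δ) (k : ℕ) :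
    ∃ c : ℝ, 0 < c ∧ ∃ N : ℕ, ∀ {W : Type v} (T : Tournament W) (X : Finset W),
      ¬ T.Contains H → N ≤ #X → ∃ S : Fin k → Finset W, (∀ i, S i ⊆ X) ∧
        (∀ i, c * #X ≤ #(S i)) ∧
        ∀ i j, i < j → Disjoint (S i) (S j) ∧ IsSparsePair T.Adj δ (S j) (S i) := by
  induction k with
  | zero => exact ⟨1, one_pos, 0, fun _ _ _ _ =>
      ⟨Fin.elim0, fun i => i.elim0, fun i => i.elim0, fun i => i.elim0⟩⟩
  | succ k ih =>
    obtain ⟨c, hc, N, ih⟩ := ih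
    obtain ⟨d, hd, M, hpair⟩ := exists_isSparsePair_of_not_contains.{u, v} H (mul_pos hδ hc)
    refine ⟨min d (c * d), by positivity, max M ⌈N / d⌉₊, fun T X hT hX => ?_⟩
    obtain ⟨A, hA, B, hB, hdisj, hAcard, hBcard, hAB⟩ := hpair T X hT ((le_max_left _ _).trans hX)
    have hNA : N ≤ #A := by
      have : (N : ℝ) / d ≤ #X := Nat.ceil_le.1 ((le_max_right _ _).trans hX)
      exact_mod_cast ((div_le_iff₀' hd).1 this).trans hAcard
    obtain ⟨S, hSA, hScard, hS⟩ := ih T A hT hNA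
    refine ⟨Fin.cons B S, Fin.forall_fin_succ.2 ⟨hB, fun i => (hSA i).trans hA⟩,
      Fin.forall_fin_succ.2 ⟨?_, fun i => ?_⟩, Fin.forall_fin_succ.2 ⟨?_, fun i => ?_⟩⟩
    · exact le_trans (by gcongr; exact min_le_left _ _) hBcard
    · calc min d (c * d) * #X ≤ c * d * #X := by gcongr; exact min_le_right _ _
        _ = c * (d * #X) := mul_assoc _ _ _
        _ ≤ c * #A := by gcongr
        _ ≤ #(S i) := hScard i
    · exact Fin.forall_fin_succ.2 ⟨fun h => absurd h (lt_irrefl 0), fun j _ =>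
        ⟨(Finset.disjoint_of_subset_left (hSA j) hdisj).symm,
          hAB.mono_left hδ.le (hSA j) (hScard j)⟩⟩
    · exact Fin.forall_fin_succ.2 ⟨fun h => absurd h (Fin.not_lt_zero _), fun j hij =>
        hS i j (Fin.succ_lt_succ_iff.1 hij)⟩

end Embedding

section Smoothness

variable {V : Type u} {W : Type v} {κ : Type*} [Preorder κ] {T : Tournament W} {δ : ℝ} {i j : κ}
  {v w : W}

/-- The arc joining `v` and `w` points backwards when `v` is placed at position `i` and `w` at
position `j`. -/
def BackAdj (T : Tournament W) (i j : κ) (v w : W) : Prop :=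
  i < j ∧ T.Adj w v ∨ j < i ∧ T.Adj v w

theorem BackAdj.symm (h : T.BackAdj i j v w) : T.BackAdj j i w v :=
  Or.symm h

theorem adj_of_not_backAdj (hij : i < j) (hvw : v ≠ w) (h : ¬ T.BackAdj i j v w) : T.Adj v w :=
  adj_of_not_adj hvw.symm fun hwv => h (.inl ⟨hij, hwv⟩)

/-- Disjoint vertex sets between which arcs almost always point forwards: every vertex of each of
them is joined by backward arcs to at most a proportion `δ` of each other one. -/
structure IsSmooth (T : Tournament W) (δ : ℝ) (S : κ → Finset W) : Prop where
  disjoint : Pairwise (Function.onFun Disjoint S)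
  card_le : ∀ i j, ∀ v ∈ S i, (#{w ∈ S j | T.BackAdj i j v w} : ℝ) ≤ δ * #(S j)

theorem isSparsePair_backAdj {κ : Type*} [LinearOrder κ] {S : κ → Finset W} (hδ : 0 ≤ δ)
    (hS : ∀ i j, i < j → IsSparsePair T.Adj δ (S j) (S i)) (i j : κ) :
    IsSparsePair (T.BackAdj i j) δ (S i) (S j) := by
  rcases lt_trichotomy i j with hlt | rfl | hgt
  · have : T.BackAdj i j = Function.swap T.Adj := by
      ext v w
      simp only [BackAdj, hlt, hlt.not_gt, true_and, false_and, or_false, Function.swap]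
    exact this ▸ (hS i j hlt).swap
  · refine isSparsePair_of_forall_card_le fun v _ => ?_
    simp only [BackAdj, lt_irrefl, false_and, or_false, Finset.filter_false, Finset.card_empty,
      Nat.cast_zero]
    positivity
  · have : T.BackAdj i j = T.Adj := by
      ext v w
      simp only [BackAdj, hgt, hgt.not_gt, true_and, false_and, false_or]
    exact this ▸ hS j i hgt

theorem exists_isSmooth_of_not_contains [Finite V] (H : Tournament V) (hδ : 0 < δ) (k : ℕ) :
    ∃ c : ℝ, 0 < c ∧ ∃ N : ℕ, ∀ {W : Type v} (T : Tournament W) (X : Finset W),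
      ¬ T.Contains H → N ≤ #X → ∃ S : Fin k → Finset W, (∀ i, S i ⊆ X) ∧
        (∀ i, c * #X ≤ #(S i)) ∧ T.IsSmooth δ S := by
  rcases Nat.eq_zero_or_pos k with rfl | hk
  · exact ⟨1, one_pos, 0, fun _ _ _ _ => ⟨Fin.elim0, fun i => i.elim0, fun i => i.elim0,
      fun i => i.elim0, fun i => i.elim0⟩⟩
  have : (0 : ℝ) < k := by exact_mod_cast hk
  have hδ' : 0 < δ / 2 * (1 / (2 * Fintype.card (Fin k))) := by
    rw [Fintype.card_fin]
    positivity
  obtain ⟨c, hc, N, hseq⟩ := exists_sparse_sequence.{u, v} H hδ' k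
  refine ⟨c / 2, by positivity, N, fun T X hT hX => ?_⟩
  obtain ⟨S, hSX, hScard, hS⟩ := hseq T X hT hX
  obtain ⟨S', hsub, hcard, hS'⟩ := exists_subsets_forall_card_le hδ
    (isSparsePair_backAdj hδ'.le fun i j hij => (hS i j hij).2)
  refine ⟨S', fun i => (hsub i).trans (hSX i), fun i => ?_, fun i j hij => ?_, hS'⟩
  · have hcard' : (#(S i) : ℝ) ≤ 2 * #(S' i) := by exact_mod_cast hcard i
    linarith [hScard i]
  · refine Finset.disjoint_of_subset_left (hsub i) (Finset.disjoint_of_subset_right (hsub j) ?_)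
    exact hij.lt_or_gt.elim (fun h => (hS i j h).1) fun h => (hS j i h).1.symm

end Smoothness

section Placements

variable {V : Type u} {W : Type v} {T : Tournament W} {H : Tournament V} {ι : Type*} {n : ℕ}

/-- The positions given to the vertices `x`, `u`, `v`, `y` of a boat when all of `x`, `u`, `v`
are put at `p` and `y` is put at `q`. -/
def boatAnchor {κ : Type*} (p q : κ) : Fin 4 → κ :=
  ![p, p, p, q]

/-- A partition of the vertices of `H` into boats, indexed by `ι`, and a choice of two positions
`base < tip` for each of them such that every arc of `H` between two different boats goes forward
when the vertices are placed by `boatAnchor`. The first three vertices of a left boat are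
consecutive and so may share a position. -/
structure BoatPlacement (H : Tournament V) (ι : Type*) (n : ℕ) where
  boatOf : V → ι
  role : V → Fin 4
  base : ι → Fin n
  tip : ι → Fin n
  base_lt_tip : ∀ C, base C < tip C
  boat_adj : ∀ v w, boatOf v = boatOf w → H.Adj v w → boat.Adj (role v) (role w)
  anchor_lt : ∀ v w, boatOf v ≠ boatOf w → H.Adj v w →
    boatAnchor (base (boatOf v)) (tip (boatOf v)) (role v) <
      boatAnchor (base (boatOf w)) (tip (boatOf w)) (role w)

theorem IsCritical.exists_boat_of_isSmooth {κ : Type*} [LinearOrder κ] {ε c δ K : ℝ}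
    {X : Finset W} {S S' : κ → Finset W} (hX : T.IsCritical ε X) (hε : 0 < ε) (hε2 : 2 * ε ≤ 1)
    (hc : 0 < c) (hcK : 16 / c ≤ K) (hK : K ^ (2 * ε) ≤ 2) (hδ0 : 0 ≤ δ) (hδ : 16 * δ ≤ 1)
    (hS : T.IsSmooth δ S) (hSX : ∀ i, S i ⊆ X) (hScard : ∀ i, c * #X ≤ #(S i))
    (hsub : ∀ i, S' i ⊆ S i) (hcard : ∀ i, #(S i) ≤ 2 * #(S' i)) {p q : κ} (hpq : p < q) :
    ∃ ψ : Fin 4 → W, (∀ a, ψ a ∈ S' (boatAnchor p q a)) ∧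
      ∀ a b, boat.Adj a b → T.Adj (ψ a) (ψ b) := by
  have hcard' (i : κ) : (#(S i) : ℝ) ≤ 2 * #(S' i) := by exact_mod_cast hcard i
  have hlarge (i : κ) : 8 * (#X : ℝ) ≤ K * #(S' i) := calc
    8 * (#X : ℝ) = 8 / c * (c * #X) := by field_simp
    _ ≤ 8 / c * (2 * #(S' i)) :=
        mul_le_mul_of_nonneg_left ((hScard i).trans (hcard' i)) (by positivity)
    _ = 16 / c * #(S' i) := by ring
    _ ≤ K * #(S' i) := by gcongr
  have hdisj : Disjoint (S' p) (S' q) := Finset.disjoint_of_subset_left (hsub p)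
    (Finset.disjoint_of_subset_right (hsub q) (hS.disjoint hpq.ne))
  have hout : ∀ y ∈ S' q, 8 * #{w ∈ S' p | T.Adj y w} ≤ #(S' p) := by
    intro y hy
    have : 8 * (#{w ∈ S' p | T.Adj y w} : ℝ) ≤ #(S' p) := calc
      8 * (#{w ∈ S' p | T.Adj y w} : ℝ) ≤ 8 * #{w ∈ S p | T.BackAdj q p y w} := by
        gcongr 8 * (Nat.cast ?_)
        refine Finset.card_le_card fun w hw => ?_
        rw [Finset.mem_filter] at hw ⊢
        exact ⟨hsub p hw.1, .inr ⟨hpq, hw.2⟩⟩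
      _ ≤ 8 * (δ * (2 * #(S' p))) := by
        gcongr
        exact (hS.card_le q p y (hsub q hy)).trans (by gcongr; exact hcard' p)
      _ = 16 * δ * #(S' p) := by ring
      _ ≤ #(S' p) := mul_le_of_le_one_left (Nat.cast_nonneg _) hδ
    exact_mod_cast this
  obtain ⟨ψ, hψS, hψ⟩ := hX.exists_boat hε hε2 ((by positivity : 0 < 16 / c).trans_le hcK) hK
    ((hsub p).trans (hSX p)) ((hsub q).trans (hSX q)) hdisj (hlarge p) (hlarge q) hout
  refine ⟨ψ, fun a => ?_, hψ⟩
  have := hψS a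
  fin_cases a <;> exact this

theorem BoatPlacement.contains_of_family {δ : ℝ} {S : Fin n → Finset W} (P : H.BoatPlacement ι n)
    (hS : T.IsSmooth δ S) {φ : ι → Fin 4 → W}
    (hφ : ∀ C, (∀ a, φ C a ∈ S (boatAnchor (P.base C) (P.tip C) a)) ∧
      ∀ a b, boat.Adj a b → T.Adj (φ C a) (φ C b))
    (hcross : ∀ C C', C ≠ C' → ∀ a a', ¬ T.BackAdj (boatAnchor (P.base C) (P.tip C) a)
      (boatAnchor (P.base C') (P.tip C') a') (φ C a) (φ C' a')) :
    T.Contains H := by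
  refine contains_of_forall_adj (φ := fun v => φ (P.boatOf v) (P.role v)) fun v w hvw => ?_
  by_cases hC : P.boatOf v = P.boatOf w
  · simpa only [hC] using (hφ (P.boatOf w)).2 _ _ (P.boat_adj v w hC hvw)
  · have hlt := P.anchor_lt v w hC hvw
    exact adj_of_not_backAdj hlt (Finset.disjoint_iff_ne.1 (hS.disjoint hlt.ne) _
      ((hφ _).1 _) _ ((hφ _).1 _)) (hcross _ _ hC _ _)

theorem BoatPlacement.satisfiesEHC [Finite V] [Finite ι] (P : H.BoatPlacement ι n) :
    SatisfiesEHC.{u, v} H := by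
  have := Fintype.ofFinite ι
  set m : ℝ := (Fintype.card ι : ℝ)
  have hm : 0 ≤ m := Nat.cast_nonneg _
  set δ : ℝ := 1 / (16 * (m + 1)) with hδ
  have hδ0 : 0 < δ := by positivity
  have hmδ : 16 * m * δ + 16 * δ = 1 := by
    rw [hδ]
    field_simp
  obtain ⟨c, hc, N, hsmooth⟩ := exists_isSmooth_of_not_contains.{u, v} H hδ0 n
  have hcK : 0 < 16 / c := by positivity
  obtain ⟨ε, hε, hε2, hK⟩ := exists_pos_rpow_two_mul_le_two (lt_max_of_lt_right (b := (N : ℝ)) hcK)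
  refine satisfiesEHC_of_forall_not_isCritical hε fun W _ T X hT hX => hT ?_
  have hNX : N ≤ #X := by
    exact_mod_cast (le_max_left _ _).trans (hX.le_card hε (by linarith)
      (rpow_le_two_of_rpow_two_mul_le (hcK.le.trans (le_max_right _ _)) hK))
  obtain ⟨S, hSX, hScard, hS⟩ := hsmooth T X hT hNX
  obtain ⟨φ, hφ, hcross⟩ := exists_family_avoiding (fun _ _ _ _ => BackAdj.symm) hS.card_le hδ0.le
    (by rw [Fintype.card_fin]; push_cast; nlinarith)
    (fun C => boatAnchor (P.base C) (P.tip C))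
    (fun _ ψ => ∀ a b, boat.Adj a b → T.Adj (ψ a) (ψ b))
    fun C S' hsub hcard => hX.exists_boat_of_isSmooth hε hε2 hc (le_max_right _ _) hK hδ0.le
      (by nlinarith) hS hSX hScard hsub hcard (P.base_lt_tip C)
  exact P.contains_of_family hS hφ hcross

end Placements

section Flotillas

variable {V : Type u} {H : Tournament V} {n : ℕ} {θ : Fin n ≃ V} {i : Fin 4 → Fin n} {p q : Fin n}

theorem backGraph_adj_iff_of_lt (H : Tournament V) (θ : Fin n ≃ V) (h : p < q) :
    (H.backGraph θ).Adj (θ p) (θ q) ↔ H.Adj (θ q) (θ p) := by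
  simp [backGraph, IsBackwardArc, h, h.not_gt]

theorem lt_of_adj_of_not_backGraph_adj {v w : V} (hvw : H.Adj v w)
    (h : ¬ (H.backGraph θ).Adj v w) : θ.symm v < θ.symm w := by
  by_contra hle
  exact h (.inl ⟨hvw, lt_of_le_of_ne (not_lt.1 hle) (θ.symm.injective.ne (ne_of_adj hvw).symm)⟩)

theorem IsBoatAt.adj_iff_of_lt (h : H.IsBoatAt θ i) {a b : Fin 4} (hab : a < b) :
    H.Adj (θ (i b)) (θ (i a)) ↔ boat.Adj b a := by
  rw [← backGraph_adj_iff_of_lt H θ (h.1 hab), h.2 a b]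
  exact backGraph_adj_iff_of_lt boat boatPathOrdering hab

theorem IsBoatAt.boat_adj_of_adj (h : H.IsBoatAt θ i) {a b : Fin 4}
    (hab : H.Adj (θ (i a)) (θ (i b))) : boat.Adj a b := by
  rcases lt_trichotomy a b with hlt | rfl | hgt
  · exact adj_of_not_adj hlt.ne' fun hba => adj_asymm hab ((h.adj_iff_of_lt hlt).2 hba)
  · exact absurd hab (H.loopless _)
  · exact (h.adj_iff_of_lt hgt).1 hab

theorem IsLeftBoat.boatAnchor_le (h : H.IsLeftBoat θ i) (a : Fin 4) :
    boatAnchor (i 0) (i 3) a ≤ i a := by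
  have hmono : Monotone i := h.1.1.monotone
  fin_cases a
  · exact le_rfl
  · exact hmono (Fin.zero_le 1)
  · exact hmono (Fin.zero_le 2)
  · exact le_rfl

theorem IsLeftBoat.lt_boatAnchor (h : H.IsLeftBoat θ i) (hp : ∀ k, p ≠ i k) {a : Fin 4}
    (hpa : p < i a) : p < boatAnchor (i 0) (i 3) a := by
  obtain ⟨-, h01, h12⟩ := h
  have h0 := hp 0
  have h1 := hp 1
  fin_cases a
  · exact hpa
  · change p < i 1 at hpa
    change p < i 0
    omega
  · change p < i 2 at hpa
    change p < i 0
    omega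
  · exact hpa

theorem IsLeftFlotilla.exists_boatPlacement (h : H.IsLeftFlotilla) :
    ∃ ι : Type u, Finite V ∧ Finite ι ∧ ∃ n, Nonempty (H.BoatPlacement ι n) := by
  obtain ⟨n, θ, hθ⟩ := h
  choose i hi hsupp using hθ
  have : Finite V := .of_equiv _ θ
  let comp := (H.backGraph θ).connectedComponentMk
  have hrole (v : V) : ∃ a, θ (i (comp v) a) = v := by
    have hv : v ∈ (comp v).supp := rfl
    rwa [hsupp] at hv
  choose role hrole using hrole
  have hcomp (C) (a : Fin 4) : comp (θ (i C a)) = C := by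
    rw [← SimpleGraph.ConnectedComponent.mem_supp_iff, hsupp C]
    exact ⟨a, rfl⟩
  refine ⟨_, this, Quot.finite _, n, ⟨{
    boatOf := comp, role := role, base := fun C => i C 0, tip := fun C => i C 3
    base_lt_tip := fun C => (hi C).1.1 (by decide)
    boat_adj := fun v w hvw hadj => ?_
    anchor_lt := fun v w hvw hadj => ?_ }⟩⟩
  · refine (hi (comp v)).1.boat_adj_of_adj ?_
    rwa [hrole v, hvw, hrole w]
  · have hlt : θ.symm v < θ.symm w := lt_of_adj_of_not_backGraph_adj hadj fun hback =>
      hvw (SimpleGraph.ConnectedComponent.connectedComponentMk_eq_of_adj hback)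
    have hpos (u : V) : i (comp u) (role u) = θ.symm u := by rw [Equiv.eq_symm_apply, hrole]
    rw [← hpos v, ← hpos w] at hlt
    refine ((hi (comp v)).boatAnchor_le (role v)).trans_lt ((hi (comp w)).lt_boatAnchor ?_ hlt)
    intro a ha
    exact hvw (by rw [← hcomp (comp v) (role v), ha, hcomp])

theorem IsLeftFlotilla.satisfiesEHC (h : H.IsLeftFlotilla) : SatisfiesEHC.{u, v} H := by
  obtain ⟨ι, hV, hι, n, ⟨P⟩⟩ := h.exists_boatPlacement
  exact P.satisfiesEHC

end Flotillas

section Reversal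

variable {V : Type u} {W : Type v} {T : Tournament W} {H : Tournament V}

/-- The tournament obtained by reversing all arcs, which turns right flotillas into left ones. -/
def reverse (T : Tournament W) : Tournament W where
  Adj a b := T.Adj b a
  loopless := T.loopless
  exactly_one a b hab := T.exactly_one b a hab.symm

theorem Contains.of_reverse (h : T.reverse.Contains H.reverse) : T.Contains H := by
  obtain ⟨X, e, he⟩ := h
  exact ⟨X, e, fun a b => he b a⟩

theorem isTransitive_induce_of_reverse {X : Set W} (h : (T.reverse.induce X).IsTransitive) :
    (T.induce X).IsTransitive := by
  intro a ha
  have hswap : (T.reverse.induce X).Adj = Function.swap (T.induce X).Adj := rfl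
  refine h a ?_
  rwa [hswap, Relation.transGen_swap]

theorem SatisfiesEHC.of_reverse (h : SatisfiesEHC.{u, v} H.reverse) : SatisfiesEHC.{u, v} H := by
  obtain ⟨ε, hε, h⟩ := h
  refine ⟨ε, hε, fun W _ T hT => ?_⟩
  obtain ⟨X, hX, hXc⟩ := h W T.reverse fun hc => hT hc.of_reverse
  exact ⟨X, isTransitive_induce_of_reverse hX, hXc⟩

theorem backGraph_reverse (H : Tournament V) {n : ℕ} (θ : Fin n ≃ V) :
    H.reverse.backGraph (Fin.revPerm.trans θ) = H.backGraph θ := by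
  ext a b
  simp only [backGraph, IsBackwardArc, reverse, Equiv.symm_trans_apply, Fin.revPerm_symm,
    Fin.revPerm_apply, Fin.rev_lt_rev]
  exact or_comm

theorem boat_backGraph_adj_rev (a b : Fin 4) :
    (boat.backGraph boatPathOrdering).Adj a.rev b.rev ↔
      (boat.backGraph boatPathOrdering).Adj a b := by
  simp only [backGraph, IsBackwardArc, boat, boatPathOrdering, Equiv.refl_symm, Equiv.refl_apply]
  decide +revert

theorem IsRightBoat.isLeftBoat_reverse {n : ℕ} {θ : Fin n ≃ V} {i : Fin 4 → Fin n}
    (h : H.IsRightBoat θ i) :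
    H.reverse.IsLeftBoat (Fin.revPerm.trans θ) fun k => (i k.rev).rev := by
  obtain ⟨⟨hmono, hi⟩, h12, h23⟩ := h
  refine ⟨⟨fun a b hab => Fin.rev_lt_rev.2 (hmono (Fin.rev_lt_rev.2 hab)), fun a b => ?_⟩, ?_, ?_⟩
  · rw [backGraph_reverse, ← boat_backGraph_adj_rev, ← hi]
    simp only [Equiv.trans_apply, Fin.revPerm_apply, Fin.rev_rev]
  · change n - (i 2 + 1 : ℕ) = n - (i 3 + 1 : ℕ) + 1
    omega
  · change n - (i 1 + 1 : ℕ) = n - (i 2 + 1 : ℕ) + 1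
    omega

theorem IsRightFlotilla.isLeftFlotilla_reverse (h : H.IsRightFlotilla) :
    H.reverse.IsLeftFlotilla := by
  obtain ⟨n, θ, hθ⟩ := h
  refine ⟨n, Fin.revPerm.trans θ, ?_⟩
  rw [backGraph_reverse]
  intro C
  obtain ⟨i, hi, hC⟩ := hθ C
  refine ⟨_, hi.isLeftBoat_reverse, hC.trans ?_⟩
  simp only [Equiv.trans_apply, Fin.revPerm_apply, Fin.rev_rev]
  exact (Fin.revPerm.surjective.range_comp fun k => θ (i k)).symm

end Reversal

end Tournament

theorem mainTheorem3 {V : Type u} (H : Tournament V) :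
    (H.IsLeftFlotilla → Tournament.SatisfiesEHC.{u, v} H) ∧
      (H.IsRightFlotilla → Tournament.SatisfiesEHC.{u, v} H) :=
  ⟨fun h => h.satisfiesEHC, fun h => h.isLeftFlotilla_reverse.satisfiesEHC.of_reverse⟩
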